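/- Let $X$ be a real or complex Banach space and consider $u'(t)=F(u(t))=Lu(t)+N(u(t))$, $u(t_0)=u_0$, on $[t_0,T]$, $t_0<T$, where: 1. $L$ is the generator of a strongly continuous semigroup $e^{tL}$ on $X$; 2. for a given order $p\ge 1$, the problem has a solution $u:[t_0,T]\to X$ which is $p+1$ times continuously differentiable with bounded derivatives, and $N:X\to X$ is $p+1$ times continuously Fréchet differentiable, with bounded derivatives, in a strip $\{x:\|x-u(t)\|<\rho\text{ for some }t\in[t_0,T]\}$, $\rho>0$. Let $\varphi_0(z)=e^z$ and $\varphi_k(z)=\int_0^1 e^{(1-\theta)z}\frac{\theta^{k-1}}{(k-1)!}\,d\theta$ for $k\ge1$. For a step size $h>0$ and $t_n=t_0+nh$, consider the $s$-stage IMEXP Runge--Kutta method $$U_{ni}=u_n+c_ih\,R_{1i}(c_ihL)F(u_n)+h\sum_{j=2}^{i-1}a_{ij}(hL)\big(N(U_{nj})-N(u_n)\big),\quad 2\le i\le s,$$ $$u_{n+1}=u_n+h\,R_1(hL)F(u_n)+h\sum_{i=2}^{s}b_i(hL)\big(N(U_{ni})-N(u_n)\big),$$ with nodes $c_i\ge0$,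 rational functions $R_1,R_{1i}$, and coefficients $a_{ij},b_i$ that are finite linear combinations of functions $z\mapsto\varphi_k(\mu z)$, $k\ge0$, $\mu\ge0$. Here $R(\tau L)=P(\tau L)Q(\tau L)^{-1}$ for $R=P/Q$ in lowest terms. If $u_n\notin D(L)$, the terms $u_n+\tau R(\tau L)F(u_n)$ are read as $(I+R(\tau L)\tau L)u_n+\tau R(\tau L)N(u_n)$, where $I+R(\tau L)\tau L$ denotes the bounded extension to $X$. Put $\psi_{k,i}(Z)=\sum_{j=2}^{i-1}a_{ij}(Z)\frac{c_j^{k-1}}{(k-1)!}-c_i^k\varphi_k(c_iZ)$ and $\psi_k(Z)=\sum_{i=2}^{s}b_i(Z)\frac{c_i^{k-1}}{(k-1)!}-\varphi_k(Z)$. The stiff order conditions of exponential Runge--Kutta methods up to order $p$ (at $Z=hL$) require the following. For all $v_2,v_3,\dots\in X$ and all bounded $r$-linear maps $A_{l,r}:X^r\to X$ ($l\ge0$, $r\ge1$), let an internal-stage expression $G(i)$ be either $\psi_{k,i}(Z)v_k$ for some $k\ge2$, of order $k$, or $\sum_{j=2}^{i-1}a_{ij}(Z)c_j^{l}A_{l,r}\big(G_1(j),\dots,G_r(j)\big)$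 with internal-stage expressions $G_1,\dots,G_r$, $r\ge1$, of order $1+l+\sum_q\operatorname{ord}G_q$. Then $$\psi_k(Z)v_k=0\ \ (2\le k\le p),\qquad \sum_{i=2}^{s}b_i(Z)c_i^{l}A_{l,r}\big(G_1(i),\dots,G_r(i)\big)=0\ \ \text{whenever } 1+l+\sum_q\operatorname{ord}G_q\le p .$$ Suppose that for some $h_0>0$, and uniformly for $0<h\le h_0$ and $t_0\le t_n\le T$, the operators below exist as bounded operators on $X$ and: * the stiff order conditions up to order $p$ hold at $Z=hL$; * $(R_{1i}(c_ihL)-\varphi_1(c_ihL))F(u(t_n))=\mathcal O(h^{p-1})$ for $2\le i\le s$, and $(R_1(hL)-\varphi_1(hL))F(u(t_n))=\mathcal O(h^p)$; * $\|R_1(hL)\|\le C$, and $\|R_{1i}(c_ihL)\|\le C$, $\|I+R_{1i}(c_ihL)c_ihL\|\le C$ for $2\le i\le s$; * $\|(I+R_1(hL)hL)^{n-j}\|\le C_S$ for $j=0,\dots,n-1$. Then there are $h_1\in(0,h_0]$ and a constant $C$ such that for all $0<h\le h_1$ and all $n\ge0$ with $t_n=t_0+nh\le T$, $$\|u_n-u(t_n)\|\le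 C\,h^p ,$$ where $C$ is independent of $n$ and $h$. -/

import Mathlib

open Set Filter Topology
open scoped NNReal Polynomial

noncomputable section

namespace IMEXP

variable {𝕜 : Type*} [RCLike 𝕜] {E : Type*} [NormedAddCommGroup E] [NormedSpace ℝ E]
  [NormedSpace 𝕜 E]

/-- A strongly continuous semigroup of bounded operators on `E` (only times `t ≥ 0` matter). -/
structure C0Semigroup (𝕜 : Type*) [RCLike 𝕜] (E : Type*) [NormedAddCommGroup E]
    [NormedSpace 𝕜 E] where
  op : ℝ → E →L[𝕜] E
  op_zero : op 0 = 1
  op_add : ∀ r t : ℝ, 0 ≤ r → 0 ≤ t → op (r + t) = op r * op t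
  tendsto_zero : ∀ x : E, Tendsto (fun t : ℝ => op t x) (𝓝[>] 0) (𝓝 x)

/-- `L` is the (in general unbounded) infinitesimal generator of the semigroup `S`: `x ∈ D(L)` and
`L x = y` exactly when the difference quotients `(S(t)x - x)/t` converge to `y` as `t → 0+`. -/
def IsGenerator (S : C0Semigroup 𝕜 E) (L : E →ₗ.[𝕜] E) : Prop :=
  ∀ x y : E, (x, y) ∈ L.graph ↔
    Tendsto (fun t : ℝ => t⁻¹ • (S.op t x - x)) (𝓝[>] 0) (𝓝 y)

/-- `φ_k(tL) x`, where `S` is the semigroup generated by `L` and `t ≥ 0`: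
`φ_0(tL) = e^{tL}`, `φ_k(tL) = ∫₀¹ e^{(1-θ)tL} θ^{k-1}/(k-1)! dθ` for `k ≥ 1`. -/
def phi (S : C0Semigroup 𝕜 E) : ℕ → ℝ → E → E
  | 0, t, x => S.op t x
  | k + 1, t, x => ∫ θ in (0 : ℝ)..1, (θ ^ k / (k.factorial : ℝ)) • S.op ((1 - θ) * t) x

/-- Coefficient functions `z ↦ ∑ λ φ_k(μ z)`, finite linear combinations of (dilated)
`φ`-functions; the key `(k, μ)` carries the weight `λ`. -/
abbrev ExpCoeff (𝕜 : Type*) [RCLike 𝕜] := (ℕ × ℝ≥0) →₀ 𝕜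

/-- The operator `a(hL)` for a coefficient function `a`. -/
def ExpCoeff.eval (a : ExpCoeff 𝕜) (S : C0Semigroup 𝕜 E) (h : ℝ) (x : E) : E :=
  a.sum fun q w => w • phi S q.1 ((q.2 : ℝ) * h) x

/-- `x ∈ D(L^{deg P})` and `y = P(L) x`, for a polynomial `P`; here `v k = L^k x`. -/
def IsPolyApply (L : E →ₗ.[𝕜] E) (P : 𝕜[X]) (x y : E) : Prop :=
  ∃ v : ℕ → E, v 0 = x ∧ (∀ k < P.natDegree, (v k, v (k + 1)) ∈ L.graph) ∧
    y = ∑ k ∈ Finset.range (P.natDegree + 1), P.coeff k • v k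

/-- The polynomial `z ↦ P(t z)`. -/
def dilate (P : 𝕜[X]) (t : ℝ) : 𝕜[X] := P.comp (Polynomial.C (t : 𝕜) * Polynomial.X)

/-- The bounded operator `B` is `R(tL)` for the rational function `R = P/Q` in lowest terms:
`Q(tL) : D(L^{deg Q}) → E` is bijective and `B` is the bounded operator that agrees with
`P(tL) Q(tL)⁻¹` on the (dense) domain of the latter, which is all of `E` if `deg P ≤ deg Q`. -/
def IsRatOp (L : E →ₗ.[𝕜] E) (R : RatFunc 𝕜) (t : ℝ) (B : E →L[𝕜] E) : Prop :=
  (∀ y : E, ∃! x : E, IsPolyApply L (dilate R.denom t) x y) ∧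
    ∀ x y z : E, IsPolyApply L (dilate R.denom t) x y → IsPolyApply L (dilate R.num t) x z →
      B y = z

open Classical in
/-- The bounded operator `R(tL)` (junk value `0` if it does not exist). -/
def ratOp (L : E →ₗ.[𝕜] E) (R : RatFunc 𝕜) (t : ℝ) : E →L[𝕜] E :=
  if hB : ∃ B, IsRatOp L R t B then hB.choose else 0

/-- `T` is the bounded extension of the densely defined operator `I + R(tL) tL`. -/
def IsStabOp (L : E →ₗ.[𝕜] E) (R : RatFunc 𝕜) (t : ℝ) (T : E →L[𝕜] E) : Prop :=
  ∀ x y : E, (x, y) ∈ L.graph → T x = x + t • ratOp L R t y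

open Classical in
/-- The bounded operator `I + R(tL) tL` on `E` (junk value `0` if it does not exist). -/
def stabOp (L : E →ₗ.[𝕜] E) (R : RatFunc 𝕜) (t : ℝ) : E →L[𝕜] E :=
  if hT : ∃ T, IsStabOp L R t T then hT.choose else 0

/-- `R(tL)` and `I + R(tL) tL` exist as bounded operators on `E`. -/
def OpsExist (L : E →ₗ.[𝕜] E) (R : RatFunc 𝕜) (t : ℝ) : Prop :=
  (∃ B, IsRatOp L R t B) ∧ ∃ T, IsStabOp L R t T

/-- `x + t R(tL) F(x)` with `F(x) = L x + N(x)`, written as `(I + R(tL) tL) x + t R(tL) N(x)`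
so that it makes sense for every `x ∈ E`; see `rationalStep_eq`. -/
def rationalStep (L : E →ₗ.[𝕜] E) (N : E → E) (R : RatFunc 𝕜) (t : ℝ) (x : E) : E :=
  stabOp L R t x + t • ratOp L R t (N x)

theorem rationalStep_eq (L : E →ₗ.[𝕜] E) (N : E → E) (R : RatFunc 𝕜) (t : ℝ)
    (hR : OpsExist L R t) (x y : E) (hxy : (x, y) ∈ L.graph) :
    rationalStep L N R t x = x + t • ratOp L R t (y + N x) := by
  have hT : stabOp L R t x = x + t • ratOp L R t y := by
    rw [stabOp, dif_pos hR.2]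
    exact hR.2.choose_spec x y hxy
  rw [rationalStep, hT, map_add, smul_add, add_assoc]

/-- The coefficients of an IMEXP Runge--Kutta method. The first stage is `U_{n1} = u_n`; the
`m = s - 1` remaining stages `i = 2, …, s` are indexed by `Fin m`. -/
structure Method (𝕜 : Type*) [RCLike 𝕜] (m : ℕ) where
  R : RatFunc 𝕜
  Ri : Fin m → RatFunc 𝕜
  c : Fin m → ℝ
  c_nonneg : ∀ i, 0 ≤ c i
  /-- Only the entries `a i j` with `j < i` are used. -/
  a : Fin m → Fin m → ExpCoeff 𝕜
  b : Fin m → ExpCoeff 𝕜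

variable {m : ℕ}

/-- The internal stages
`U_i = x + c_i h R_i(c_i hL) F(x) + h ∑_{j<i} a_{ij}(hL) (N(U_j) - N(x))`. -/
def stage (M : Method 𝕜 m) (S : C0Semigroup 𝕜 E) (L : E →ₗ.[𝕜] E) (N : E → E) (h : ℝ) (x : E)
    (i : Fin m) : E :=
  rationalStep L N (M.Ri i) (M.c i * h) x +
    h • ∑ j : Fin i.val, (M.a i (j.castLE i.isLt.le)).eval S h
      (N (stage M S L N h x (j.castLE i.isLt.le)) - N x)
termination_by i.val
decreasing_by exact j.isLt

/-- One step: `x + h R(hL) F(x) + h ∑_i b_i(hL) (N(U_i) - N(x))`. -/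
def step (M : Method 𝕜 m) (S : C0Semigroup 𝕜 E) (L : E →ₗ.[𝕜] E) (N : E → E) (h : ℝ) (x : E) :
    E :=
  rationalStep L N M.R h x + h • ∑ i, (M.b i).eval S h (N (stage M S L N h x i) - N x)

/-- The numerical solution `u_0, u_1, u_2, …` with constant step size `h`. -/
def numSol (M : Method 𝕜 m) (S : C0Semigroup 𝕜 E) (L : E →ₗ.[𝕜] E) (N : E → E) (u₀ : E)
    (h : ℝ) : ℕ → E
  | 0 => u₀
  | n + 1 => step M S L N h (numSol M S L N u₀ h n)

/-- Trees indexing the stiff order conditions: a leaf `leaf k` stands for `ψ_{k+2}`, and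
`node l r ch` for the factor `c^l` together with an `(r+1)`-linear map applied to the subtrees. -/
inductive StiffTree : Type
  | leaf (k : ℕ) : StiffTree
  | node (l r : ℕ) (ch : Fin (r + 1) → StiffTree) : StiffTree

/-- The order of the condition belonging to a tree. -/
def StiffTree.order : StiffTree → ℕ
  | .leaf k => k + 2
  | .node l _ ch => 1 + l + ∑ q, (ch q).order

/-- Internal-stage expressions, at `Z = hL`:
`leaf k` gives `ψ_{k+2,i}(Z) v_{k+2}` with
`ψ_{q,i}(Z) = ∑_{j<i} a_{ij}(Z) c_j^{q-1}/(q-1)! - c_i^q φ_q(c_i Z)`, and `node l r ch` gives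
`∑_{j<i} a_{ij}(Z) c_j^l A_{l,r+1}(…)`, the multilinear map being applied to the expressions of
the subtrees for stage `j`. -/
def stageExpr (M : Method 𝕜 m) (S : C0Semigroup 𝕜 E) (h : ℝ)
    (A : ∀ _ r : ℕ, ContinuousMultilinearMap 𝕜 (fun _ : Fin r => E) E) (v : ℕ → E) :
    StiffTree → Fin m → E
  | .leaf k, i =>
      ∑ j ∈ Finset.univ.filter (fun j => j < i),
        (M.c j ^ (k + 1) / ((k + 1).factorial : ℝ)) • (M.a i j).eval S h (v (k + 2))
      - M.c i ^ (k + 2) • phi S (k + 2) (M.c i * h) (v (k + 2))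
  | .node l r ch, i =>
      ∑ j ∈ Finset.univ.filter (fun j => j < i),
        M.c j ^ l • (M.a i j).eval S h (A l (r + 1) fun q => stageExpr M S h A v (ch q) j)

/-- The same expressions for the final update, with `b_i` in place of `a_{ij}` and
`ψ_q(Z) = ∑_i b_i(Z) c_i^{q-1}/(q-1)! - φ_q(Z)`. -/
def rootExpr (M : Method 𝕜 m) (S : C0Semigroup 𝕜 E) (h : ℝ)
    (A : ∀ _ r : ℕ, ContinuousMultilinearMap 𝕜 (fun _ : Fin r => E) E) (v : ℕ → E) :
    StiffTree → E
  | .leaf k =>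
      ∑ i, (M.c i ^ (k + 1) / ((k + 1).factorial : ℝ)) • (M.b i).eval S h (v (k + 2))
      - phi S (k + 2) h (v (k + 2))
  | .node l r ch =>
      ∑ i, M.c i ^ l • (M.b i).eval S h (A l (r + 1) fun q => stageExpr M S h A v (ch q) i)

/-- The stiff order conditions of exponential Runge--Kutta methods up to order `p`, at `Z = hL`,
for arbitrary bounded multilinear maps `A_{l,r}` on `E`. For example, up to order four they read
`∑ b_i(Z) c_i = φ_2(Z)`; `∑ b_i(Z) c_i²/2! = φ_3(Z)`, `∑ b_i(Z) J ψ_{2,i}(Z) = 0`;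
`∑ b_i(Z) c_i³/3! = φ_4(Z)`, `∑ b_i(Z) J ψ_{3,i}(Z) = 0`,
`∑ b_i(Z) J ∑_{j<i} a_{ij}(Z) J ψ_{2,j}(Z) = 0`, `∑ b_i(Z) c_i K ψ_{2,i}(Z) = 0`.
(The condition of order one, `∑ b_i = φ_1` with the sum including the first stage, is built into
the form of the method.) -/
def StiffOrderConditions (M : Method 𝕜 m) (S : C0Semigroup 𝕜 E) (h : ℝ) (p : ℕ) : Prop :=
  ∀ (A : ∀ _ r : ℕ, ContinuousMultilinearMap 𝕜 (fun _ : Fin r => E) E) (v : ℕ → E)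
    (τ : StiffTree), τ.order ≤ p → rootExpr M S h A v τ = 0

/-- `u` is a solution on `[t₀, T]` of `u' = L u + N(u)`, `u(t₀) = u₀`. -/
def IsSolution (L : E →ₗ.[𝕜] E) (N : E → E) (u₀ : E) (t₀ T : ℝ) (u : ℝ → E) : Prop :=
  u t₀ = u₀ ∧ ∀ t ∈ Icc t₀ T, ∃ y : E, (u t, y) ∈ L.graph ∧
    HasDerivWithinAt u (y + N (u t)) (Icc t₀ T) t

/-- The open tube of radius `ρ` around the solution curve. -/
def strip (u : ℝ → E) (t₀ T ρ : ℝ) : Set E := {x | ∃ t ∈ Icc t₀ T, ‖x - u t‖ < ρ}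

/-- The solution and the nonlinearity have `K` continuous derivatives, uniformly bounded on
`[t₀, T]` and on a strip along the solution, respectively. -/
def Regular (𝕜 : Type*) [RCLike 𝕜] [NormedSpace 𝕜 E] (N : E → E) (u : ℝ → E) (t₀ T : ℝ)
    (K : ℕ) : Prop :=
  (ContDiffOn ℝ K u (Icc t₀ T) ∧
    ∃ C : ℝ, ∀ k ≤ K, ∀ t ∈ Icc t₀ T, ‖iteratedDerivWithin k u (Icc t₀ T) t‖ ≤ C) ∧
  ∃ ρ > 0, ContDiffOn 𝕜 K N (strip u t₀ T ρ) ∧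
    ∃ C : ℝ, ∀ k ≤ K, ∀ x ∈ strip u t₀ T ρ, ‖iteratedFDeriv 𝕜 k N x‖ ≤ C

/-- The conditions
`(R_i(c_i hL) - φ_1(c_i hL)) F(u(t_n)) = O(h^{p-1})` and `(R(hL) - φ_1(hL)) F(u(t_n)) = O(h^p)`,
uniformly for `0 < h ≤ h₀` and `t_n = t₀ + n h ≤ T`, where `F(x) = L x + N(x)`. -/
def RationalOrderConditions (M : Method 𝕜 m) (S : C0Semigroup 𝕜 E) (L : E →ₗ.[𝕜] E) (N : E → E)
    (u : ℝ → E) (t₀ T h₀ : ℝ) (p : ℕ) : Prop :=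
  ∃ C : ℝ, ∀ h ∈ Ioc 0 h₀, ∀ n : ℕ, t₀ + n * h ≤ T →
    ∀ y : E, (u (t₀ + n * h), y) ∈ L.graph →
      (∀ i, ‖ratOp L (M.Ri i) (M.c i * h) (y + N (u (t₀ + n * h)))
          - phi S 1 (M.c i * h) (y + N (u (t₀ + n * h)))‖ ≤ C * h ^ (p - 1)) ∧
      ‖ratOp L M.R h (y + N (u (t₀ + n * h))) - phi S 1 h (y + N (u (t₀ + n * h)))‖ ≤ C * h ^ p

/-- The operators `R(hL)`, `R_i(c_i hL)`, `I + R(hL) hL`, `I + R_i(c_i hL) c_i hL` exist as bounded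
operators, and `R(hL)`, `R_i(c_i hL)`, `I + R_i(c_i hL) c_i hL` are bounded uniformly for
`0 < h ≤ h₀`. -/
def StabilityBounds (M : Method 𝕜 m) (L : E →ₗ.[𝕜] E) (h₀ : ℝ) : Prop :=
  (∀ h ∈ Ioc 0 h₀, OpsExist L M.R h ∧ ∀ i, OpsExist L (M.Ri i) (M.c i * h)) ∧
  ∃ C : ℝ, ∀ h ∈ Ioc 0 h₀, ‖ratOp L M.R h‖ ≤ C ∧
    ∀ i, ‖ratOp L (M.Ri i) (M.c i * h)‖ ≤ C ∧ ‖stabOp L (M.Ri i) (M.c i * h)‖ ≤ C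

/-- The bound `‖(I + R(hL) hL)^{n-j}‖ ≤ C_S`, `j = 0, …, n-1`, uniformly for `0 < h ≤ h₀` and
`t₀ + n h ≤ T`. -/
def PowerBounded (M : Method 𝕜 m) (L : E →ₗ.[𝕜] E) (t₀ T h₀ : ℝ) : Prop :=
  ∃ C_S : ℝ, ∀ h ∈ Ioc 0 h₀, ∀ n : ℕ, t₀ + n * h ≤ T →
    ∀ j < n, ‖stabOp L M.R h ^ (n - j)‖ ≤ C_S

end IMEXP

end

/-!
The proof is the classical pair consistency and stability.

*Stability.* Near the solution, one step applied to two initial values `x`, `y` differs by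
`(I + R(hL)hL)(x - y) + O(h ‖x - y‖)`, because `N` is Lipschitz in the strip and all other
operators are uniformly bounded (`UniformExpansion.exists_step_sub_le`). As the powers of
`I + R(hL)hL` are bounded, a discrete Gronwall argument (`norm_le_of_powerBounded`) turns a local
error `O(h^(p+1))` into a global error `O(h^p)`; the latter bound also keeps the numerical solution
in the neighbourhood where the estimates hold.

*Consistency.* Two expansions are compared. For the exact solution, differentiating
`u' = Lu + N(u)` and using that the generator is closed gives `u^(k)(t) ∈ D(L)` and
`u^(k+1) = L u^(k) + f^(k)` with `f = N ∘ u`, `k ≤ p`. The recurrence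
`φ_k(τL) = 1/k! + φ_{k+1}(τL) τL` on `D(L)` then makes the Taylor polynomial of `u` telescope into
`u + τ φ_1(τL) u' + ∑_{k=2}^p τ^k φ_k(τL) f^(k-1) + O(τ^(p+1))`
(`IsGenerator.sum_taylor_eq`), which replaces the variation-of-constants formula. It holds for
every small `τ ≥ 0` if `u` is extended smoothly beyond `T`, as is needed for nodes `c_i > 1`.

For the numerical solution, let `E_i` be the defect of the `i`-th stage. The Taylor expansion of
`N` at `u(t+c_jh)` in powers of `E_j`, with coefficients expanded in powers of `c_jh`, yields
`E_i = ∑_k h^k ψ_{k,i} f^(k-1) + ∑_{l,r} ∑_{j<i} a_{ij} c_j^l h^(1+l) A_{l,r}(E_j, …, E_j) + O(h^p)`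
(`UniformExpansion.exists_norm_update_le`). Iterating this relation from `E = 0` reaches every
stage after finitely many rounds, since `j < i` (`UniformExpansion.exists_norm_stage_sub_le`).
The iterates `approxStage` are by multilinearity finite sums of the tree expressions of the stiff
order conditions, with multiplicity one for each ordered tree (`exists_approxStage_eq_sum`).
The powers of `h` are absorbed into the vectors and multilinear maps, so an expression belonging to
a tree of order `q` is `O(h^q)` (`exists_norm_stageExpr_le`). In the final update the order
conditions remove all trees of order at most `p`, which leaves `O(h^(p+1))` (`exists_norm_root_le`).
-/

namespace IMEXP

/-! ### Strongly continuous semigroups and the operators `φ_k(tL)` -/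

section Semigroup

variable {𝕜 : Type*} [RCLike 𝕜] {E : Type*} [NormedAddCommGroup E] [NormedSpace 𝕜 E]

theorem C0Semigroup.op_add_apply (S : C0Semigroup 𝕜 E) {r t : ℝ} (hr : 0 ≤ r) (ht : 0 ≤ t)
    (x : E) : S.op (r + t) x = S.op r (S.op t x) := by
  rw [S.op_add r t hr ht]; rfl

/-- A strongly continuous semigroup is bounded near `0`, by the uniform boundedness principle. -/
theorem C0Semigroup.exists_norm_le_near_zero [CompleteSpace E] (S : C0Semigroup 𝕜 E) :
    ∃ δ > 0, ∃ C : ℝ, ∀ t ∈ Icc (0 : ℝ) δ, ‖S.op t‖ ≤ C := by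
  by_contra! hcon
  -- otherwise some `t n ∈ [0, 1/(n+1)]` has `‖S(t n)‖ > n`
  have h1 : ∀ n : ℕ, ∃ t ∈ Icc (0 : ℝ) (1 / ((n : ℝ) + 1)), (n : ℝ) < ‖S.op t‖ := fun n =>
    hcon _ (by positivity) n
  choose t ht hn using h1
  have htend : Tendsto t atTop (𝓝[≥] 0) := by
    refine tendsto_nhdsWithin_iff.2 ⟨?_, Eventually.of_forall fun n => (ht n).1⟩
    exact squeeze_zero (fun n => (ht n).1) (fun n => (ht n).2)
      tendsto_one_div_add_atTop_nhds_zero_nat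
  have hcont : ∀ x : E, Tendsto (fun r : ℝ => S.op r x) (𝓝[≥] 0) (𝓝 x) := by
    intro x
    have h0 : ContinuousWithinAt (fun r : ℝ => S.op r x) (Ioi 0) 0 := by
      simpa [ContinuousWithinAt, S.op_zero] using S.tendsto_zero x
    have := (continuousWithinAt_Ioi_iff_Ici.1 h0)
    simpa [ContinuousWithinAt, S.op_zero] using this
  obtain ⟨C, hC⟩ := banach_steinhaus (g := fun n => S.op (t n)) (by
    intro x
    obtain ⟨C, hC⟩ := (((hcont x).comp htend).norm).bddAbove_range
    exact ⟨C, fun n => hC ⟨n, rfl⟩⟩)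
  obtain ⟨n, hn'⟩ := exists_nat_gt C
  exact absurd ((hn n).trans_le (hC n)) (not_lt.2 hn'.le)

theorem C0Semigroup.op_nat_mul (S : C0Semigroup 𝕜 E) {t : ℝ} (ht : 0 ≤ t) (n : ℕ) :
    S.op (n * t) = S.op t ^ n := by
  induction n with
  | zero => simp [S.op_zero]
  | succ n ih =>
    rw [pow_succ, ← ih, ← S.op_add _ _ (by positivity) ht]
    congr 1; push_cast; ring

theorem C0Semigroup.exists_norm_le [CompleteSpace E] (S : C0Semigroup 𝕜 E) (τ : ℝ) :
    ∃ C : ℝ, 0 ≤ C ∧ ∀ t ∈ Icc (0 : ℝ) τ, ‖S.op t‖ ≤ C := by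
  obtain ⟨δ, hδ, C, hC⟩ := S.exists_norm_le_near_zero
  have hC0 : 0 ≤ C := (norm_nonneg _).trans (hC 0 ⟨le_rfl, hδ.le⟩)
  obtain ⟨n, hn⟩ := exists_nat_gt (τ / δ)
  refine ⟨C ^ (n + 1), by positivity, fun t ht => ?_⟩
  have ht' : t = ((n + 1 : ℕ) : ℝ) * (t / ((n + 1 : ℕ) : ℝ)) := by
    field_simp
  have hpos : (0 : ℝ) < ((n + 1 : ℕ) : ℝ) := by positivity
  have h0 : 0 ≤ t / ((n + 1 : ℕ) : ℝ) := div_nonneg ht.1 hpos.le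
  rw [ht', S.op_nat_mul h0]
  refine (norm_pow_le' _ n.succ_pos).trans ?_
  refine pow_le_pow_left₀ (norm_nonneg _) (hC _ ⟨h0, ?_⟩) _
  rw [div_le_iff₀ hpos]
  rw [div_lt_iff₀ hδ] at hn
  have := ht.2
  push_cast
  nlinarith

theorem C0Semigroup.continuousOn [CompleteSpace E] (S : C0Semigroup 𝕜 E) (x : E) :
    ContinuousOn (fun t : ℝ => S.op t x) (Ici 0) := by
  intro t ht
  obtain ⟨C, hC0, hC⟩ := S.exists_norm_le (t + 1)
  have h0 : ContinuousWithinAt (fun r : ℝ => S.op r x) (Ici 0) 0 := by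
    refine continuousWithinAt_Ioi_iff_Ici.1 ?_
    simpa [ContinuousWithinAt, S.op_zero] using S.tendsto_zero x
  rw [Metric.continuousWithinAt_iff] at h0 ⊢
  intro ε hε
  obtain ⟨δ, hδ, hδ'⟩ := h0 (ε / (C + 1)) (by positivity)
  -- `S(r)x - S(t)x = S(min r t)(S(|r - t|)x - x)` up to sign
  have key : ∀ a b : ℝ, 0 ≤ a → a ≤ b → a ≤ t + 1 → b - a < δ →
      dist (S.op b x) (S.op a x) < ε := by
    intro a b ha hab hat hd
    have h1 : S.op b x = S.op a (S.op (b - a) x) := by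
      rw [← S.op_add_apply ha (by linarith)]; congr 2; ring
    have h2 := hδ' (x := b - a) (by simpa using hab) (by
      rw [Real.dist_eq, sub_zero, abs_of_nonneg (by linarith)]; exact hd)
    rw [S.op_zero] at h2
    rw [h1, dist_eq_norm, ← map_sub]
    refine ((S.op a).le_opNorm _).trans_lt ?_
    have h3 : ‖S.op (b - a) x - x‖ < ε / (C + 1) := by simpa [dist_eq_norm] using h2
    calc ‖S.op a‖ * ‖S.op (b - a) x - x‖ ≤ C * (ε / (C + 1)) := by
          gcongr; exact hC a ⟨ha, hat⟩
      _ < (C + 1) * (ε / (C + 1)) := by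
          have : 0 < ε / (C + 1) := by positivity
          nlinarith
      _ = ε := by field_simp
  refine ⟨min δ 1, by positivity, fun r hr hd => ?_⟩
  have hr : 0 ≤ r := hr
  have ht : 0 ≤ t := ht
  rw [Real.dist_eq, lt_min_iff, abs_lt, abs_lt] at hd
  rcases le_total t r with h | h
  · exact key t r ht h (by linarith) (by linarith)
  · rw [dist_comm]; exact key r t hr h (by linarith) (by linarith)

theorem C0Semigroup.continuousOn_comp_mul [CompleteSpace E] (S : C0Semigroup 𝕜 E) {t : ℝ}
    (ht : 0 ≤ t) (x : E) :
    ContinuousOn (fun θ : ℝ => S.op (θ * t) x) (Icc 0 1) :=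
  (S.continuousOn x).comp (by fun_prop) fun _ hθ => mul_nonneg hθ.1 ht

variable [NormedSpace ℝ E]

theorem phi_succ_eq (S : C0Semigroup 𝕜 E) (k : ℕ) (t : ℝ) (x : E) :
    phi S (k + 1) t x =
      ∫ θ in (0 : ℝ)..1, ((1 - θ) ^ k / (k.factorial : ℝ)) • S.op (θ * t) x := by
  have := intervalIntegral.integral_comp_sub_left (a := 0) (b := 1)
    (fun θ : ℝ => (θ ^ k / (k.factorial : ℝ)) • S.op ((1 - θ) * t) x) 1
  simpa [phi] using this.symm

theorem norm_phi_integrand_le (S : C0Semigroup 𝕜 E) (k : ℕ) {t τ C : ℝ} (ht : t ∈ Icc 0 τ)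
    (hC : ∀ t ∈ Icc (0 : ℝ) τ, ‖S.op t‖ ≤ C) (x : E) {θ : ℝ}
    (hθ : θ ∈ Icc (0 : ℝ) 1) :
    ‖((1 - θ) ^ k / (k.factorial : ℝ)) • S.op (θ * t) x‖ ≤ C * ‖x‖ := by
  have h1 : (1 - θ) ^ k / (k.factorial : ℝ) ≤ 1 := by
    rw [div_le_one (by positivity)]
    calc (1 - θ) ^ k ≤ 1 := pow_le_one₀ (by linarith [hθ.2]) (by linarith [hθ.1])
      _ ≤ (k.factorial : ℝ) := by exact_mod_cast k.factorial_pos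
  have h2 : 0 ≤ (1 - θ) ^ k / (k.factorial : ℝ) :=
    div_nonneg (pow_nonneg (by linarith [hθ.2]) _) (by positivity)
  have h3 : ‖S.op (θ * t)‖ ≤ C :=
    hC _ ⟨mul_nonneg hθ.1 ht.1, (mul_le_of_le_one_left ht.1 hθ.2).trans ht.2⟩
  rw [norm_smul, Real.norm_of_nonneg h2]
  calc _ ≤ 1 * (C * ‖x‖) := by
        gcongr
        exact (S.op _).le_of_opNorm_le h3 x
    _ = _ := one_mul _

variable [CompleteSpace E]

theorem intervalIntegrable_phi (S : C0Semigroup 𝕜 E) (k : ℕ) {t : ℝ} (ht : 0 ≤ t) (x : E) :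
    IntervalIntegrable (fun θ : ℝ => ((1 - θ) ^ k / (k.factorial : ℝ)) • S.op (θ * t) x)
      MeasureTheory.volume 0 1 := by
  apply ContinuousOn.intervalIntegrable
  rw [uIcc_of_le zero_le_one]
  exact ContinuousOn.smul (by fun_prop) (S.continuousOn_comp_mul ht x)

variable [IsScalarTower ℝ 𝕜 E]

/-- For `t` in a compact interval, `φ_k(tL)` is a uniformly bounded family of operators. -/
theorem exists_clm_phi (S : C0Semigroup 𝕜 E) (k : ℕ) (τ : ℝ) :
    ∃ (B : ℝ → E →L[𝕜] E) (C : ℝ), 0 ≤ C ∧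
      ∀ t ∈ Icc (0 : ℝ) τ, (∀ x, phi S k t x = B t x) ∧ ‖B t‖ ≤ C := by
  obtain ⟨C, hC0, hC⟩ := S.exists_norm_le τ
  cases k with
  | zero => exact ⟨S.op, C, hC0, fun t ht => ⟨fun _ => rfl, hC t ht⟩⟩
  | succ k =>
    have hex : ∀ t : ℝ, ∃ B : E →L[𝕜] E, t ∈ Icc (0 : ℝ) τ →
        (∀ x, phi S (k + 1) t x = B x) ∧ ‖B‖ ≤ C := by
      intro t
      by_cases ht : t ∈ Icc (0 : ℝ) τ
      swap
      · exact ⟨0, fun h => absurd h ht⟩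
      have hbd : ∀ x, ‖phi S (k + 1) t x‖ ≤ C * ‖x‖ := by
        intro x
        rw [phi_succ_eq]
        refine (intervalIntegral.norm_integral_le_of_norm_le_const (C := C * ‖x‖) ?_).trans
          (by simp)
        intro θ hθ
        rw [uIoc_of_le zero_le_one] at hθ
        exact norm_phi_integrand_le S k ht hC x ⟨hθ.1.le, hθ.2⟩
      let B : E →ₗ[𝕜] E :=
        { toFun := phi S (k + 1) t
          map_add' := by
            intro x y
            simp only [phi_succ_eq, map_add, smul_add]
            exact intervalIntegral.integral_add (intervalIntegrable_phi S k ht.1 x)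
              (intervalIntegrable_phi S k ht.1 y)
          map_smul' := by
            intro w x
            simp only [phi_succ_eq, map_smul, RingHom.id_apply]
            rw [← intervalIntegral.integral_smul]
            congr 1; ext θ; rw [smul_comm] }
      exact ⟨B.mkContinuous C hbd, fun _ => ⟨fun _ => rfl, B.mkContinuous_norm_le hC0 _⟩⟩
    choose B hB using hex
    exact ⟨B, C, hC0, hB⟩

/-- For `h` in a compact interval, `a(hL)` is a uniformly bounded family of operators. -/
theorem exists_clm_eval (S : C0Semigroup 𝕜 E) (a : ExpCoeff 𝕜) (τ : ℝ) :
    ∃ (B : ℝ → E →L[𝕜] E) (C : ℝ), 0 ≤ C ∧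
      ∀ t ∈ Icc (0 : ℝ) τ, (∀ x, a.eval S t x = B t x) ∧ ‖B t‖ ≤ C := by
  have h1 : ∀ q : ℕ × ℝ≥0, ∃ (B : ℝ → E →L[𝕜] E) (C : ℝ), 0 ≤ C ∧
      ∀ t ∈ Icc (0 : ℝ) τ, (∀ x, phi S q.1 ((q.2 : ℝ) * t) x = B t x) ∧ ‖B t‖ ≤ C := by
    intro q
    obtain ⟨B, C, hC0, hB⟩ := exists_clm_phi S q.1 (q.2 * τ)
    exact ⟨fun t => B (q.2 * t), C, hC0, fun t ht =>
      hB _ ⟨mul_nonneg q.2.2 ht.1, mul_le_mul_of_nonneg_left ht.2 q.2.2⟩⟩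
  choose B C hC0 hB using h1
  refine ⟨fun t => a.sum fun q w => w • B q t, a.sum fun q w => ‖w‖ * C q,
    Finset.sum_nonneg fun q _ => mul_nonneg (norm_nonneg _) (hC0 q), fun t ht => ⟨fun x => ?_, ?_⟩⟩
  · simp only [ExpCoeff.eval, Finsupp.sum, sum_apply,
      smul_apply, (hB _ t ht).1]
  · refine norm_sum_le_of_le _ fun q _ => ?_
    rw [norm_smul]
    exact mul_le_mul_of_nonneg_left (hB q t ht).2 (norm_nonneg _)

end Semigroup

/-! ### The generator -/

section Generator

variable {𝕜 : Type*} [RCLike 𝕜] {E : Type*} [NormedAddCommGroup E] [NormedSpace 𝕜 E]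
  [NormedSpace ℝ E] {S : C0Semigroup 𝕜 E} {L : E →ₗ.[𝕜] E}

theorem tendsto_phi_one [CompleteSpace E] (S : C0Semigroup 𝕜 E) (y : E) :
    Tendsto (fun t => phi S 1 t y) (𝓝[>] 0) (𝓝 y) := by
  rw [Metric.tendsto_nhdsWithin_nhds]
  intro ε hε
  have h0 := S.tendsto_zero y
  rw [Metric.tendsto_nhdsWithin_nhds] at h0
  obtain ⟨δ, hδ, hδ'⟩ := h0 (ε / 2) (by positivity)
  refine ⟨δ, hδ, fun t ht hd => ?_⟩
  have ht : 0 < t := ht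
  rw [Real.dist_eq, sub_zero, abs_of_pos ht] at hd
  have h1 : phi S 1 t y - y = ∫ θ in (0 : ℝ)..1,
      (((1 - θ) ^ 0 / (Nat.factorial 0 : ℝ)) • S.op (θ * t) y - y) := by
    rw [intervalIntegral.integral_sub (intervalIntegrable_phi S 0 ht.le y) (by simp),
      ← phi_succ_eq]
    simp
  rw [dist_eq_norm, h1]
  refine (intervalIntegral.norm_integral_le_of_norm_le_const (C := ε / 2) ?_).trans_lt
    (by simpa using hε)
  intro θ hθ
  rw [uIoc_of_le zero_le_one] at hθ
  have h2 := hδ' (x := θ * t) (mul_pos hθ.1 ht) (by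
    rw [Real.dist_eq, sub_zero, abs_of_pos (mul_pos hθ.1 ht)]
    exact (mul_le_of_le_one_left ht.le hθ.2).trans_lt hd)
  simpa [dist_eq_norm] using h2.le

variable [IsScalarTower ℝ 𝕜 E]

theorem IsGenerator.hasDerivWithinAt (hL : IsGenerator S L) {x y : E} (hxy : (x, y) ∈ L.graph)
    {t : ℝ} (ht : 0 ≤ t) : HasDerivWithinAt (fun r => S.op r x) (S.op t y) (Ioi t) t := by
  rw [hasDerivWithinAt_iff_tendsto_slope' (by simp)]
  have h1 := ((S.op t).continuous.tendsto y).comp ((hL x y).1 hxy)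
  have h2 : Tendsto (fun r : ℝ => r - t) (𝓝[>] t) (𝓝[>] 0) := by
    refine tendsto_nhdsWithin_iff.2 ⟨?_, ?_⟩
    · refine Tendsto.mono_left ?_ nhdsWithin_le_nhds
      exact (Continuous.tendsto' (by fun_prop) _ _ (by simp))
    · filter_upwards [self_mem_nhdsWithin] with r hr
      exact sub_pos.2 (mem_Ioi.1 hr)
  refine (h1.comp h2).congr' ?_
  filter_upwards [self_mem_nhdsWithin] with r hr
  have hr : t < r := hr
  have h3 : S.op r x = S.op t (S.op (r - t) x) := by
    rw [← S.op_add_apply ht (by linarith)]; congr 2; ring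
  simp only [Function.comp, slope_def_module, h3, ← map_sub]
  rw [ContinuousLinearMap.map_smul_of_tower]

variable [CompleteSpace E]

/-- The recurrence `φ_k(tL) = 1/k! + φ_{k+1}(tL) tL` on `D(L)`. -/
theorem IsGenerator.phi_eq (hL : IsGenerator S L) {x y : E} (hxy : (x, y) ∈ L.graph)
    {t : ℝ} (ht : 0 ≤ t) (k : ℕ) :
    phi S k t x = ((k.factorial : ℝ)⁻¹) • x + t • phi S (k + 1) t y := by
  -- derivative of `θ ↦ S(θt)x`
  have hd : ∀ θ ∈ Ioo (0 : ℝ) 1,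
      HasDerivWithinAt (fun r => S.op (r * t) x) (t • S.op (θ * t) y) (Ioi θ) θ := by
    intro θ hθ
    rcases ht.eq_or_lt with rfl | ht'
    · simpa using hasDerivWithinAt_const θ (Ioi θ) (S.op 0 x)
    · have h1 := hL.hasDerivWithinAt hxy (mul_nonneg hθ.1.le ht)
      have h2 : HasDerivWithinAt (fun r : ℝ => r * t) t (Ioi θ) θ := by
        simpa using ((hasDerivAt_id θ).mul_const t).hasDerivWithinAt
      exact h1.scomp θ h2 fun r hr => mul_lt_mul_of_pos_right hr ht'
  cases k with
  | zero =>
    have h1 := intervalIntegral.integral_eq_sub_of_hasDeriv_right_of_le (zero_le_one' ℝ)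
      (S.continuousOn_comp_mul ht x) hd
      (by simpa [Pi.smul_def] using (intervalIntegrable_phi S 0 ht y).smul t)
    rw [phi_succ_eq, ← intervalIntegral.integral_smul]
    simp only [zero_mul, one_mul, S.op_zero] at h1
    simp only [pow_zero, Nat.factorial_zero, Nat.cast_one, div_one, one_smul, inv_one, h1]
    simp [phi]
  | succ k =>
    have hp : ∀ θ : ℝ, HasDerivAt (fun r : ℝ => (1 - r) ^ (k + 1) / ((k + 1).factorial : ℝ))
        (-((1 - θ) ^ k / (k.factorial : ℝ))) θ := by
      intro θ
      have h1 := ((((hasDerivAt_id θ).const_sub 1).pow (k + 1)).div_const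
        ((k + 1).factorial : ℝ))
      refine h1.congr_deriv ?_
      rw [Nat.factorial_succ]
      push_cast
      have : (k.factorial : ℝ) ≠ 0 := by positivity
      field_simp
      simp
    have i1 : IntervalIntegrable (fun θ : ℝ => ((1 - θ) ^ (k + 1) / ((k + 1).factorial : ℝ)) •
        t • S.op (θ * t) y) MeasureTheory.volume 0 1 := by
      simpa only [Pi.smul_def, smul_comm t] using (intervalIntegrable_phi S (k + 1) ht y).smul t
    have i2 : IntervalIntegrable (fun θ : ℝ => -((1 - θ) ^ k / (k.factorial : ℝ)) •
        S.op (θ * t) x) MeasureTheory.volume 0 1 := by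
      simpa only [Pi.neg_def, neg_smul] using (intervalIntegrable_phi S k ht x).neg
    have h1 := intervalIntegral.integral_eq_sub_of_hasDeriv_right_of_le (zero_le_one' ℝ)
      (ContinuousOn.smul (by fun_prop) (S.continuousOn_comp_mul ht x))
      (fun θ hθ => (hp θ).hasDerivWithinAt.smul (hd θ hθ))
      (i1.add i2)
    rw [intervalIntegral.integral_add i1 i2] at h1
    simp only [neg_smul, intervalIntegral.integral_neg, smul_comm _ t,
      intervalIntegral.integral_smul] at h1
    rw [← phi_succ_eq, ← phi_succ_eq] at h1
    simp only [Pi.smul_apply', sub_self, ne_eq, Nat.add_eq_zero_iff, one_ne_zero, and_false,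
      not_false_eq_true, zero_pow, zero_div, zero_smul, sub_zero, one_pow, zero_mul, S.op_zero,
      zero_sub, one_div, one_apply_eq_self] at h1
    rw [← sub_eq_add_neg, sub_eq_iff_eq_add] at h1
    rw [h1]; abel

/-- A generator is a closed operator: pass to the limit in `S(t)x = x + t φ_1(tL) Lx`. -/
theorem IsGenerator.isClosed_graph (hL : IsGenerator S L) :
    IsClosed (L.graph : Set (E × E)) := by
  refine isClosed_of_closure_subset fun z hz => ?_
  obtain ⟨s, hs, hlim⟩ := mem_closure_iff_seq_limit.1 hz
  obtain ⟨x, y⟩ := z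
  have hx : Tendsto (fun n => (s n).1) atTop (𝓝 x) := (continuous_fst.tendsto _).comp hlim
  have hy : Tendsto (fun n => (s n).2) atTop (𝓝 y) := (continuous_snd.tendsto _).comp hlim
  refine (hL x y).2 ((tendsto_phi_one S y).congr' ?_)
  filter_upwards [self_mem_nhdsWithin] with t ht
  have ht : 0 < t := ht
  obtain ⟨B, C, -, hB⟩ := exists_clm_phi S 1 t
  have hB1 := (hB t ⟨ht.le, le_rfl⟩).1
  have h1 : ∀ n, S.op t (s n).1 = (s n).1 + t • B t (s n).2 := by
    intro n
    have := hL.phi_eq (x := (s n).1) (y := (s n).2) (hs n) ht.le 0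
    simpa [phi, ← hB1] using this
  have h2 : S.op t x = x + t • B t y := by
    refine tendsto_nhds_unique (((S.op t).continuous.tendsto x).comp hx) ?_
    have h3 : Tendsto (fun n => (s n).1 + t • B t (s n).2) atTop (𝓝 (x + t • B t y)) :=
      hx.add ((((B t).continuous.tendsto y).comp hy).const_smul t)
    exact h3.congr fun n => (h1 n).symm
  rw [h2, hB1, add_sub_cancel_left, inv_smul_smul₀ ht.ne']

end Generator

/-! ### Taylor expansions -/

section Taylor

variable {F : Type*} [NormedAddCommGroup F] [NormedSpace ℝ F]

/-- A `C^n` function on a compact interval extends to a `C^n` function on the line: integrate an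
extension of its derivative. -/
theorem exists_contDiff_extension [CompleteSpace F] {a b : ℝ} (hab : a < b) (n : ℕ) :
    ∀ u : ℝ → F, ContDiffOn ℝ n u (Icc a b) →
      ∃ v : ℝ → F, ContDiff ℝ n v ∧ EqOn v u (Icc a b) := by
  induction n with
  | zero =>
    intro u hu
    have hu0 : ContinuousOn u (Icc a b) := hu.continuousOn
    refine ⟨IccExtend hab.le ((Icc a b).domRestrict u), ?_, fun t ht => ?_⟩
    · exact contDiff_zero.2 (hu0.domRestrict.Icc_extend')
    · rw [IccExtend_of_mem _ _ ht]; rfl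
  | succ n ih =>
    intro u hu
    have hu' : ContDiffOn ℝ ((n : ℕ∞) + 1) u (Icc a b) := by exact_mod_cast hu
    obtain ⟨hd, -, hu1⟩ := (contDiffOn_succ_iff_derivWithin (uniqueDiffOn_Icc hab)).1 hu'
    obtain ⟨w, hw, hwu⟩ := ih _ hu1
    have hwc : Continuous w := hw.continuous
    have hder : ∀ t, HasDerivAt (fun t => u a + ∫ r in a..t, w r) (w t) t := fun t =>
      (intervalIntegral.integral_hasDerivAt_right (hwc.intervalIntegrable _ _)
        (hwc.stronglyMeasurableAtFilter _ _) hwc.continuousAt).const_add (u a)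
    refine ⟨fun t => u a + ∫ r in a..t, w r, ?_, fun t ht => ?_⟩
    · have h1 : deriv (fun t => u a + ∫ r in a..t, w r) = w := funext fun t => (hder t).deriv
      have : ContDiff ℝ ((n : ℕ∞) + 1) (fun t => u a + ∫ r in a..t, w r) := by
        refine contDiff_succ_iff_deriv.2 ⟨fun t => (hder t).differentiableAt, by simp, ?_⟩
        rw [h1]; exact_mod_cast hw
      exact_mod_cast this
    · have h1 := intervalIntegral.integral_eq_sub_of_hasDerivAt_of_le (f := u) (f' := w) ht.1
        (hd.continuousOn.mono (Icc_subset_Icc_right ht.2))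
        (fun x hx => by
          have hx' : x ∈ Ioo a b := ⟨hx.1, hx.2.trans_le ht.2⟩
          rw [hwu (Ioo_subset_Icc_self hx')]
          exact ((hd x (Ioo_subset_Icc_self hx')).hasDerivWithinAt).hasDerivAt
            (Icc_mem_nhds hx'.1 hx'.2))
        (hwc.intervalIntegrable _ _)
      simp only [h1]; abel

/-- Taylor's formula with remainder bound, for a chain of functions `g 0, g 1, …`, each the
derivative of its predecessor. -/
theorem norm_sub_taylor_le_of_chain {a b C : ℝ} (n : ℕ) :
    ∀ g : ℕ → ℝ → F,
      (∀ k < n, ∀ t ∈ Icc a b, HasDerivWithinAt (g k) (g (k + 1) t) (Icc a b) t) →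
      (∀ t ∈ Icc a b, ‖g n t‖ ≤ C) → ∀ t ∈ Icc a b,
        ‖g 0 t - ∑ k ∈ Finset.range n, ((t - a) ^ k / (k.factorial : ℝ)) • g k a‖
          ≤ C * (t - a) ^ n := by
  induction n with
  | zero => intro g _ hC t ht; simpa using hC t ht
  | succ n ih =>
    intro g hg hC t ht
    have hC0 : 0 ≤ C := (norm_nonneg _).trans (hC t ht)
    have h1 := ih (fun k => g (k + 1)) (fun k hk => hg (k + 1) (by omega)) hC
    have hp : ∀ (k : ℕ) (r : ℝ), HasDerivAt
        (fun r : ℝ => (r - a) ^ (k + 1) / ((k + 1).factorial : ℝ))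
        ((r - a) ^ k / (k.factorial : ℝ)) r := by
      intro k r
      refine ((((hasDerivAt_id r).sub_const a).pow (k + 1)).div_const
        ((k + 1).factorial : ℝ)).congr_deriv ?_
      rw [Nat.factorial_succ]
      push_cast
      have : (k.factorial : ℝ) ≠ 0 := by positivity
      field_simp
      simp
    have hder : ∀ r ∈ Icc a b, HasDerivWithinAt
        (fun r => g 0 r - ∑ k ∈ Finset.range (n + 1), ((r - a) ^ k / (k.factorial : ℝ)) • g k a)
        (g 1 r - ∑ k ∈ Finset.range n, ((r - a) ^ k / (k.factorial : ℝ)) • g (k + 1) a)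
        (Icc a b) r := by
      intro r hr
      refine (hg 0 (by omega) r hr).sub ?_
      simp only [Finset.sum_range_succ', pow_zero, Nat.factorial_zero, Nat.cast_one, div_one,
        one_smul]
      refine HasDerivWithinAt.add_const _ (HasDerivWithinAt.fun_sum fun k _ => ?_)
      exact ((hp k r).smul_const (g (k + 1) a)).hasDerivWithinAt
    refine image_norm_le_of_norm_deriv_right_le_deriv_boundary
      (B := fun r => C * (r - a) ^ (n + 1)) (B' := fun r => C * ((n + 1) * (r - a) ^ n))
      (fun r hr => (hder r hr).continuousWithinAt)
      (fun r hr => (hder r (Ico_subset_Icc_self hr)).mono_of_mem_nhdsWithin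
        (Icc_mem_nhdsGE_of_mem hr)) ?_ ?_ ?_ ht
    · simp [Finset.sum_range_succ']
    · intro r
      have := ((((hasDerivAt_id r).sub_const a).pow (n + 1)).const_mul C)
      exact this.congr_deriv (by simp)
    · intro r hr
      refine (h1 r (Ico_subset_Icc_self hr)).trans ?_
      have : 0 ≤ (r - a) ^ n := pow_nonneg (sub_nonneg.2 hr.1) _
      have hn : (0 : ℝ) ≤ n := n.cast_nonneg
      have := mul_nonneg hC0 (mul_nonneg hn this)
      nlinarith

theorem hasDerivAt_iteratedDeriv {g : ℝ → F} {U : Set ℝ} (hU : IsOpen U) {n : ℕ}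
    (hg : ContDiffOn ℝ n g U) {k : ℕ} (hk : k < n) {t : ℝ} (ht : t ∈ U) :
    HasDerivAt (iteratedDeriv k g) (iteratedDeriv (k + 1) g t) t := by
  rw [iteratedDeriv_succ, hasDerivAt_deriv_iff]
  have h1 := (hg.differentiableOn_iteratedDerivWithin (m := k) (by exact_mod_cast hk)
    hU.uniqueDiffOn).congr (fun x hx => (iteratedDerivWithin_of_isOpen hU hx).symm)
  exact (h1 t ht).differentiableAt (hU.mem_nhds ht)

/-- Uniform bounds for the derivatives and the Taylor remainders of a `C^n` function on a compact
interval. -/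
theorem exists_taylor_bound {g : ℝ → F} {U : Set ℝ} (hU : IsOpen U) {n : ℕ}
    (hg : ContDiffOn ℝ n g U) {a b : ℝ} (hab : Icc a b ⊆ U) :
    ∃ C : ℝ, 0 ≤ C ∧ ∀ k ≤ n, ∀ t ∈ Icc a b, ‖iteratedDeriv k g t‖ ≤ C ∧
      ∀ s ∈ Icc t b, ‖g s - ∑ l ∈ Finset.range k,
        ((s - t) ^ l / (l.factorial : ℝ)) • iteratedDeriv l g t‖ ≤ C * (s - t) ^ k := by
  have h1 : ∀ k : ℕ, ∃ C : ℝ, 0 ≤ C ∧ (k ≤ n → ∀ t ∈ Icc a b, ‖iteratedDeriv k g t‖ ≤ C) := by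
    intro k
    by_cases hk : k ≤ n
    · have hc : ContinuousOn (iteratedDeriv k g) (Icc a b) :=
        ((hg.continuousOn_iteratedDerivWithin (m := k) (by exact_mod_cast hk)
          hU.uniqueDiffOn).congr
            (fun x hx => (iteratedDerivWithin_of_isOpen hU hx).symm)).mono hab
      obtain ⟨C, hC⟩ := isCompact_Icc.exists_bound_of_continuousOn hc
      exact ⟨max C 0, le_max_right _ _, fun _ t ht => (hC t ht).trans (le_max_left _ _)⟩
    · exact ⟨0, le_rfl, fun h => absurd h hk⟩
  choose C hC0 hC using h1
  have hle : ∀ k ≤ n, C k ≤ ∑ k ∈ Finset.range (n + 1), C k := fun k hk =>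
    Finset.single_le_sum (fun i _ => hC0 i) (Finset.mem_range.2 (by omega))
  refine ⟨∑ k ∈ Finset.range (n + 1), C k, Finset.sum_nonneg fun i _ => hC0 i,
    fun k hk t ht => ⟨(hC k hk t ht).trans (hle k hk), fun s hs => ?_⟩⟩
  have hsub : Icc t b ⊆ Icc a b := Icc_subset_Icc_left ht.1
  have := norm_sub_taylor_le_of_chain (a := t) (b := b) k (fun k => iteratedDeriv k g)
    (fun j hj r hr => (hasDerivAt_iteratedDeriv hU hg (hj.trans_le hk)
      (hab (hsub hr))).hasDerivWithinAt)
    (fun r hr => (hC k hk r (hsub hr)).trans (hle k hk)) s hs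
  simpa using this

end Taylor

section TaylorFDeriv

variable {𝕜 : Type*} [RCLike 𝕜] {E : Type*} [NormedAddCommGroup E] [NormedSpace 𝕜 E]
  {F : Type*} [NormedAddCommGroup F] [NormedSpace 𝕜 F]

theorem differentiableAt_iteratedFDeriv {N : E → F} {Ω : Set E} (hΩ : IsOpen Ω) {n : ℕ}
    (hN : ContDiffOn 𝕜 n N Ω) {r : ℕ} (hr : r < n) {x : E} (hx : x ∈ Ω) :
    DifferentiableAt 𝕜 (iteratedFDeriv 𝕜 r N) x := by
  have h1 : ContDiffAt 𝕜 n N x := hN.contDiffAt (hΩ.mem_nhds hx)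
  have h2 : ContDiffAt 𝕜 ((1 : ℕ) : WithTop ℕ∞) (iteratedFDeriv 𝕜 r N) x :=
    h1.iteratedFDeriv_right (by exact_mod_cast (by omega : 1 + r ≤ n))
  exact h2.differentiableAt (by simp)

variable [NormedSpace ℝ E] [IsScalarTower ℝ 𝕜 E] [NormedSpace ℝ F] [IsScalarTower ℝ 𝕜 F]

/-- Taylor's formula along a segment for a function on a normed space. -/
theorem norm_sub_taylor_le {N : E → F} {Ω : Set E} (hΩ : IsOpen Ω) {n : ℕ}
    (hN : ContDiffOn 𝕜 n N Ω) {C : ℝ} (hC : ∀ x ∈ Ω, ‖iteratedFDeriv 𝕜 n N x‖ ≤ C) {x e : E}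
    (hseg : ∀ s ∈ Icc (0 : ℝ) 1, x + s • e ∈ Ω) :
    ‖N (x + e) - ∑ r ∈ Finset.range n,
      ((r.factorial : ℝ)⁻¹) • iteratedFDeriv 𝕜 r N x (fun _ => e)‖ ≤ C * ‖e‖ ^ n := by
  have h1 := norm_sub_taylor_le_of_chain (a := 0) (b := 1) (C := C * ‖e‖ ^ n) n
    (fun r s => iteratedFDeriv 𝕜 r N (x + s • e) (fun _ => e)) ?_ ?_ 1 (by simp)
  · simpa using h1
  · intro r hr s hs
    refine HasDerivAt.hasDerivWithinAt ?_
    have hd :=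
      ((differentiableAt_iteratedFDeriv hΩ hN hr (hseg s hs)).hasFDerivAt).restrictScalars ℝ
    have h2 : HasDerivAt (fun s : ℝ => x + s • e) e s := by
      simpa using ((hasDerivAt_id s).smul_const e).const_add x
    have h3 := hd.comp_hasDerivAt s h2
    have h4 := (((ContinuousMultilinearMap.apply 𝕜 (fun _ : Fin r => E) F
      (fun _ => e)).hasFDerivAt).restrictScalars ℝ).comp_hasDerivAt s h3
    refine h4.congr_deriv ?_
    rw [iteratedFDeriv_succ_apply_left]
    rfl
  · intro s hs
    refine ((iteratedFDeriv 𝕜 n N (x + s • e)).le_opNorm _).trans ?_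
    rw [Finset.prod_const, Finset.card_univ, Fintype.card_fin]
    gcongr
    exact hC _ (hseg s hs)

/-- The derivatives of `N` along a curve. -/
theorem contDiffOn_iteratedFDeriv_comp {N : E → F} {Ω : Set E} (hΩ : IsOpen Ω) {n m r : ℕ}
    (hN : ContDiffOn 𝕜 n N Ω) (hr : m + r ≤ n) {v : ℝ → E} (hv : ContDiff ℝ n v) :
    ContDiffOn ℝ m (fun t => iteratedFDeriv 𝕜 r N (v t)) (v ⁻¹' Ω) := by
  intro t ht
  have h1 : ContDiffAt 𝕜 n N (v t) := hN.contDiffAt (hΩ.mem_nhds ht)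
  have h2 : ContDiffAt 𝕜 m (iteratedFDeriv 𝕜 r N) (v t) :=
    h1.iteratedFDeriv_right (by exact_mod_cast hr)
  have h3 : ContDiffAt ℝ m v t := hv.contDiffAt.of_le (by exact_mod_cast (by omega : m ≤ n))
  exact ((h2.restrict_scalars ℝ).comp t h3).contDiffWithinAt

end TaylorFDeriv

/-! ### Tree expansions -/

section Trees

variable {𝕜 : Type*} [RCLike 𝕜] {E : Type*} [NormedAddCommGroup E] [NormedSpace ℝ E]
  [NormedSpace 𝕜 E] [IsScalarTower ℝ 𝕜 E] [CompleteSpace E] {m : ℕ}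

theorem ExpCoeff.exists_clm (a : ExpCoeff 𝕜) (S : C0Semigroup 𝕜 E) {h : ℝ} (hh : 0 ≤ h) :
    ∃ B : E →L[𝕜] E, ∀ x, a.eval S h x = B x := by
  obtain ⟨B, _, _, hB⟩ := exists_clm_eval S a h
  exact ⟨B h, (hB h ⟨hh, le_rfl⟩).1⟩

theorem ExpCoeff.eval_sum (a : ExpCoeff 𝕜) (S : C0Semigroup 𝕜 E) {h : ℝ} (hh : 0 ≤ h)
    {ι : Type*} (s : Finset ι) (f : ι → E) :
    a.eval S h (∑ i ∈ s, f i) = ∑ i ∈ s, a.eval S h (f i) := by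
  obtain ⟨B, hB⟩ := a.exists_clm S hh
  simp only [hB, map_sum]

theorem ExpCoeff.eval_sub (a : ExpCoeff 𝕜) (S : C0Semigroup 𝕜 E) {h : ℝ} (hh : 0 ≤ h)
    (x y : E) : a.eval S h (x - y) = a.eval S h x - a.eval S h y := by
  obtain ⟨B, hB⟩ := a.exists_clm S hh
  simp only [hB, map_sub]

theorem ExpCoeff.eval_smul (a : ExpCoeff 𝕜) (S : C0Semigroup 𝕜 E) {h : ℝ} (hh : 0 ≤ h)
    (w : ℝ) (x : E) : a.eval S h (w • x) = w • a.eval S h x := by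
  obtain ⟨B, hB⟩ := a.exists_clm S hh
  simp only [hB, ContinuousLinearMap.map_smul_of_tower]

/-- Uniform bound for weighted sums of coefficient operators. -/
theorem exists_norm_sum_eval_le (S : C0Semigroup 𝕜 E) (h₀ : ℝ) (J : Finset (Fin m))
    (α : Fin m → ExpCoeff 𝕜) (w : Fin m → ℝ) :
    ∃ C : ℝ, 0 ≤ C ∧ ∀ h ∈ Icc 0 h₀, ∀ (f : Fin m → E) (D : ℝ), (∀ j ∈ J, ‖f j‖ ≤ D) →
      ‖∑ j ∈ J, w j • (α j).eval S h (f j)‖ ≤ C * D := by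
  choose B C hC0 hB using fun j => exists_clm_eval S (α j) h₀
  refine ⟨∑ j ∈ J, ‖w j‖ * C j,
    Finset.sum_nonneg fun j _ => mul_nonneg (norm_nonneg _) (hC0 j), fun h hh f D hf => ?_⟩
  rw [Finset.sum_mul]
  refine norm_sum_le_of_le _ fun j hj => ?_
  rw [norm_smul, (hB j h hh).1, mul_assoc]
  gcongr
  exact ((B j h).le_of_opNorm_le (hB j h hh).2 _).trans
    (mul_le_mul_of_nonneg_left (hf j hj) (hC0 j))

/-- The elementary maps and vectors carry the powers of the step size that belong to their
order. -/
def Scaled (K h : ℝ) (A : ∀ _ r : ℕ, ContinuousMultilinearMap 𝕜 (fun _ : Fin r => E) E)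
    (v : ℕ → E) : Prop :=
  (∀ l r, ‖A l r‖ ≤ K * h ^ (1 + l)) ∧ ∀ k, ‖v k‖ ≤ K * h ^ k

omit [NormedSpace ℝ E] [IsScalarTower ℝ 𝕜 E] [CompleteSpace E] in
theorem Scaled.norm_apply_le {K h : ℝ}
    {A : ∀ _ r : ℕ, ContinuousMultilinearMap 𝕜 (fun _ : Fin r => E) E} {v : ℕ → E}
    (hA : Scaled K h A v) (l : ℕ) {r : ℕ} {x : Fin r → E} {C : Fin r → ℝ} {d : Fin r → ℕ}
    (hx : ∀ q, ‖x q‖ ≤ C q * h ^ d q) :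
    ‖A l r x‖ ≤ (K * ∏ q, C q) * h ^ (1 + l + ∑ q, d q) := by
  refine ((A l r).le_opNorm x).trans ?_
  calc ‖A l r‖ * ∏ q, ‖x q‖ ≤ (K * h ^ (1 + l)) * ∏ q, (C q * h ^ d q) :=
        mul_le_mul (hA.1 l r) (Finset.prod_le_prod (fun _ _ => norm_nonneg _) fun q _ => hx q)
          (Finset.prod_nonneg fun _ _ => norm_nonneg _) ((norm_nonneg _).trans (hA.1 l r))
    _ = _ := by
        rw [Finset.prod_mul_distrib, Finset.prod_pow_eq_pow_sum, pow_add _ (1 + l)]; ring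

/-- With scaled data, the internal-stage expression of a tree has the size that its order
predicts. -/
theorem exists_norm_stageExpr_le (M : Method 𝕜 m) (S : C0Semigroup 𝕜 E) (h₀ K : ℝ)
    (hK : 0 ≤ K) (τ : StiffTree) : ∀ i, ∃ C : ℝ, 0 ≤ C ∧ ∀ h ∈ Icc 0 h₀, ∀ A v,
      Scaled K h A v → ‖stageExpr M S h A v τ i‖ ≤ C * h ^ τ.order := by
  induction τ with
  | leaf k =>
    intro i
    obtain ⟨C₁, hC₁, h1⟩ := exists_norm_sum_eval_le S h₀
      (Finset.univ.filter (fun j => j < i)) (M.a i)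
      (fun j => M.c j ^ (k + 1) / ((k + 1).factorial : ℝ))
    obtain ⟨B, C₂, hC₂, h2⟩ := exists_clm_phi S (k + 2) (M.c i * h₀)
    have hc : 0 ≤ M.c i ^ (k + 2) := pow_nonneg (M.c_nonneg i) _
    refine ⟨C₁ * K + M.c i ^ (k + 2) * (C₂ * K), by positivity, fun h hh A v hA => ?_⟩
    rw [stageExpr, StiffTree.order, add_mul]
    refine (norm_sub_le _ _).trans (add_le_add ?_ ?_)
    · rw [mul_assoc]
      exact h1 h hh _ _ fun j _ => hA.2 (k + 2)
    · have h3 := h2 (M.c i * h) ⟨mul_nonneg (M.c_nonneg i) hh.1,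
        mul_le_mul_of_nonneg_left hh.2 (M.c_nonneg i)⟩
      rw [norm_smul, Real.norm_of_nonneg hc, mul_assoc, mul_assoc, h3.1]
      gcongr
      exact ((B _).le_of_opNorm_le h3.2 _).trans (mul_le_mul_of_nonneg_left (hA.2 _) hC₂)
  | node l r ch ih =>
    intro i
    choose C hC0 hC using ih
    obtain ⟨C₁, hC₁, h1⟩ := exists_norm_sum_eval_le S h₀
      (Finset.univ.filter (fun j => j < i)) (M.a i) (fun j => M.c j ^ l)
    refine ⟨C₁ * (K * ∏ q, ∑ j, C q j), mul_nonneg hC₁ (mul_nonneg hK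
      (Finset.prod_nonneg fun q _ => Finset.sum_nonneg fun j _ => hC0 q j)),
      fun h hh A v hA => ?_⟩
    rw [stageExpr, StiffTree.order, mul_assoc]
    refine h1 h hh _ _ fun j _ => hA.norm_apply_le l fun q => (hC q j h hh A v hA).trans ?_
    exact mul_le_mul_of_nonneg_right
      (Finset.single_le_sum (fun j _ => hC0 q j) (Finset.mem_univ j)) (pow_nonneg hh.1 _)

/-- The corresponding bound for the expressions of the final update; only trees with a root node
are needed. -/
theorem exists_norm_rootExpr_node_le (M : Method 𝕜 m) (S : C0Semigroup 𝕜 E) (h₀ K : ℝ)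
    (hK : 0 ≤ K) (l r : ℕ) (ch : Fin (r + 1) → StiffTree) : ∃ C : ℝ, 0 ≤ C ∧
      ∀ h ∈ Icc 0 h₀, ∀ A v, Scaled K h A v →
        ‖rootExpr M S h A v (.node l r ch)‖ ≤ C * h ^ (StiffTree.node l r ch).order := by
  choose C hC0 hC using fun q => exists_norm_stageExpr_le M S h₀ K hK (ch q)
  obtain ⟨C₁, hC₁, h1⟩ := exists_norm_sum_eval_le S h₀ Finset.univ M.b (fun j => M.c j ^ l)
  refine ⟨C₁ * (K * ∏ q, ∑ j, C q j), mul_nonneg hC₁ (mul_nonneg hK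
    (Finset.prod_nonneg fun q _ => Finset.sum_nonneg fun j _ => hC0 q j)),
    fun h hh A v hA => ?_⟩
  rw [rootExpr, StiffTree.order, mul_assoc]
  refine h1 h hh _ _ fun j _ => hA.norm_apply_le l fun q => (hC q j h hh A v hA).trans ?_
  exact mul_le_mul_of_nonneg_right
    (Finset.single_le_sum (fun j _ => hC0 q j) (Finset.mem_univ j)) (pow_nonneg hh.1 _)

theorem StiffTree.two_le_order (τ : StiffTree) : 2 ≤ τ.order := by
  induction τ with
  | leaf k => simp [StiffTree.order]
  | node l r ch ih =>
    have := Finset.single_le_sum (f := fun q => (ch q).order) (fun q _ => Nat.zero_le _)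
      (Finset.mem_univ 0)
    have h0 := ih 0
    simp only [StiffTree.order]
    omega

/-- Picard iterates of the stage equations with truncated Taylor expansions: starting from `0`,
insert the last iterate into
`Y_i = ∑_{k=2}^p ψ_{k,i} v_k + ∑_{l,r<p} ∑_{j<i} a_{ij} c_j^l A_{l,r+1}(Y_j, …, Y_j)`. -/
noncomputable def approxStage (M : Method 𝕜 m) (S : C0Semigroup 𝕜 E) (p : ℕ) (h : ℝ)
    (A : ∀ _ r : ℕ, ContinuousMultilinearMap 𝕜 (fun _ : Fin r => E) E) (v : ℕ → E) :
    ℕ → Fin m → E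
  | 0, _ => 0
  | k + 1, i => ∑ q ∈ Finset.range (p - 1), stageExpr M S h A v (.leaf q) i +
      ∑ l ∈ Finset.range p, ∑ r ∈ Finset.range p, ∑ j ∈ Finset.univ.filter (fun j => j < i),
        M.c j ^ l • (M.a i j).eval S h (A l (r + 1) fun _ => approxStage M S p h A v k j)

/-- A node of the sum of finitely many tree expressions is, by multilinearity, the sum over all
choices of the children. -/
theorem sum_eval_map_sum (M : Method 𝕜 m) (S : C0Semigroup 𝕜 E) {h : ℝ} (hh : 0 ≤ h)
    (A : ∀ _ r : ℕ, ContinuousMultilinearMap 𝕜 (fun _ : Fin r => E) E)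
    (J : Finset (Fin m)) (α : Fin m → ExpCoeff 𝕜) (p : ℕ) {ι : Type} [Fintype ι]
    (g : ι → Fin m → E) :
    ∑ l ∈ Finset.range p, ∑ r ∈ Finset.range p, ∑ j ∈ J,
        M.c j ^ l • (α j).eval S h (A l (r + 1) fun _ => ∑ x, g x j) =
      ∑ z : (Σ lr : Fin p × Fin p, (Fin (lr.2 + 1) → ι)), ∑ j ∈ J,
        M.c j ^ (z.1.1 : ℕ) • (α j).eval S h (A z.1.1 (z.1.2 + 1) fun q => g (z.2 q) j) := by
  classical
  rw [Fintype.sum_sigma, Fintype.sum_prod_type, Finset.sum_range]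
  refine Finset.sum_congr rfl fun l _ => ?_
  rw [Finset.sum_range]
  refine Finset.sum_congr rfl fun r _ => ?_
  rw [Finset.sum_comm]
  refine Finset.sum_congr rfl fun j _ => ?_
  rw [ContinuousMultilinearMap.map_sum, ExpCoeff.eval_sum _ _ hh, Finset.smul_sum]

theorem exists_approxStage_eq_sum (M : Method 𝕜 m) (S : C0Semigroup 𝕜 E) (p k : ℕ) :
    ∃ (ι : Type) (_ : Fintype ι) (tr : ι → StiffTree), ∀ h, 0 ≤ h → ∀ A v i,
      approxStage M S p h A v k i = ∑ x, stageExpr M S h A v (tr x) i := by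
  induction k with
  | zero => exact ⟨Empty, inferInstance, Empty.elim, fun h _ A v i => by simp [approxStage]⟩
  | succ k ih =>
    obtain ⟨ι, _, tr, htr⟩ := ih
    refine ⟨Fin (p - 1) ⊕ (Σ lr : Fin p × Fin p, (Fin (lr.2 + 1) → ι)), inferInstance,
      Sum.elim (fun q => .leaf q) (fun z => .node z.1.1 z.1.2 fun q => tr (z.2 q)),
      fun h hh A v i => ?_⟩
    rw [Fintype.sum_sum_type, approxStage, Finset.sum_range]
    congr 1
    simp only [htr h hh A v, Sum.elim_inr, stageExpr]
    exact sum_eval_map_sum M S hh A _ (M.a i) p fun x => stageExpr M S h A v (tr x)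

theorem exists_norm_approxStage_le (M : Method 𝕜 m) (S : C0Semigroup 𝕜 E) (p k : ℕ)
    (h₀ K : ℝ) (hK : 0 ≤ K) : ∃ C : ℝ, 0 ≤ C ∧ ∀ h ∈ Icc 0 h₀, ∀ A v, Scaled K h A v →
      ∀ i, ‖approxStage M S p h A v k i‖ ≤ C * h := by
  obtain ⟨ι, _, tr, htr⟩ := exists_approxStage_eq_sum M S p k
  choose C hC0 hC using fun x => exists_norm_stageExpr_le M S h₀ K hK (tr x)
  have hpos : ∀ x i, 0 ≤ C x i * |h₀| ^ ((tr x).order - 1) := fun x i =>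
    mul_nonneg (hC0 x i) (by positivity)
  refine ⟨∑ i, ∑ x, C x i * |h₀| ^ ((tr x).order - 1),
    Finset.sum_nonneg fun i _ => Finset.sum_nonneg fun x _ => hpos x i,
    fun h hh A v hA i => ?_⟩
  have hi : ∑ x, C x i * |h₀| ^ ((tr x).order - 1) ≤
      ∑ i, ∑ x, C x i * |h₀| ^ ((tr x).order - 1) :=
    Finset.single_le_sum (f := fun i => ∑ x, C x i * |h₀| ^ ((tr x).order - 1))
      (fun i _ => Finset.sum_nonneg fun x _ => hpos x i) (Finset.mem_univ i)
  refine le_trans ?_ (mul_le_mul_of_nonneg_right hi hh.1)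
  rw [htr h hh.1 A v i, Finset.sum_mul]
  refine norm_sum_le_of_le _ fun x _ => (hC x i h hh A v hA).trans ?_
  have h2 := (tr x).two_le_order
  rw [mul_assoc]
  refine mul_le_mul_of_nonneg_left ?_ (hC0 x i)
  calc h ^ (tr x).order = h ^ ((tr x).order - 1) * h := by
        rw [← pow_succ]; congr 1; omega
    _ ≤ |h₀| ^ ((tr x).order - 1) * h := by
        gcongr
        · exact hh.1
        · exact hh.1
        · exact hh.2.trans (le_abs_self _)

/-- The order conditions remove every tree of order at most `p` from the final update. -/
theorem exists_norm_root_le (M : Method 𝕜 m) (S : C0Semigroup 𝕜 E) (p k : ℕ)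
    (h₀ K : ℝ) (hK : 0 ≤ K) : ∃ C : ℝ, 0 ≤ C ∧ ∀ h ∈ Icc 0 h₀, StiffOrderConditions M S h p →
      ∀ A v, Scaled K h A v →
      ‖∑ l ∈ Finset.range p, ∑ r ∈ Finset.range p, ∑ j,
        M.c j ^ l • (M.b j).eval S h (A l (r + 1) fun _ => approxStage M S p h A v k j)‖
          ≤ C * h ^ (p + 1) := by
  obtain ⟨ι, _, tr, htr⟩ := exists_approxStage_eq_sum M S p k
  let nd : (Σ lr : Fin p × Fin p, (Fin (lr.2 + 1) → ι)) → StiffTree := fun z =>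
    .node z.1.1 z.1.2 fun q => tr (z.2 q)
  choose C hC0 hC using fun z : (Σ lr : Fin p × Fin p, (Fin (lr.2 + 1) → ι)) =>
    exists_norm_rootExpr_node_le M S h₀ K hK z.1.1 z.1.2 fun q => tr (z.2 q)
  refine ⟨∑ z, C z * |h₀| ^ ((nd z).order - (p + 1)),
    Finset.sum_nonneg fun z _ => mul_nonneg (hC0 z) (by positivity),
    fun h hh hcond A v hA => ?_⟩
  have h1 := sum_eval_map_sum M S hh.1 A Finset.univ M.b p
    fun x => stageExpr M S h A v (tr x)
  simp only [htr h hh.1 A v, h1, Finset.sum_mul]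
  refine norm_sum_le_of_le _ fun z _ => ?_
  change ‖rootExpr M S h A v (nd z)‖ ≤ _
  have hpos := hh.1
  by_cases hz : (nd z).order ≤ p
  · rw [hcond A v _ hz, norm_zero]
    exact mul_nonneg (mul_nonneg (hC0 z) (by positivity)) (by positivity)
  · refine (hC z h hh A v hA).trans ?_
    rw [mul_assoc]
    refine mul_le_mul_of_nonneg_left ?_ (hC0 z)
    calc h ^ (nd z).order = h ^ ((nd z).order - (p + 1)) * h ^ (p + 1) := by
          rw [← pow_add]; congr 1; omega
      _ ≤ _ := by
          gcongr
          exact hh.2.trans (le_abs_self _)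

end Trees

/-! ### Expansion of the exact solution -/

section Solution

variable {𝕜 : Type*} [RCLike 𝕜] {E : Type*} [NormedAddCommGroup E] [NormedSpace ℝ E]
  [NormedSpace 𝕜 E] [IsScalarTower ℝ 𝕜 E] [CompleteSpace E]
  {S : C0Semigroup 𝕜 E} {L : E →ₗ.[𝕜] E}

omit [CompleteSpace E] in
/-- A closed operator commutes with differentiation. -/
theorem hasDerivWithinAt_mem_graph (hL : IsClosed (L.graph : Set (E × E))) {x y : ℝ → E}
    {x' y' : E} {s : Set ℝ} {t : ℝ} (hs : UniqueDiffWithinAt ℝ s t) (ht : t ∈ s)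
    (hxy : ∀ r ∈ s, (x r, y r) ∈ L.graph) (hx : HasDerivWithinAt x x' s t)
    (hy : HasDerivWithinAt y y' s t) : (x', y') ∈ L.graph := by
  have hne : (𝓝[s \ {t}] t).NeBot :=
    accPt_principal_iff_nhdsWithin.1 (uniqueDiffWithinAt_iff_accPt.1 hs)
  have h1 := (hasDerivWithinAt_iff_tendsto_slope.1 hx).prodMk_nhds
    (hasDerivWithinAt_iff_tendsto_slope.1 hy)
  refine hL.mem_of_tendsto h1 ?_
  filter_upwards [self_mem_nhdsWithin] with r hr
  have h2 : (slope x t r, slope y t r) = (((r - t)⁻¹ : ℝ) : 𝕜) • ((x r, y r) - (x t, y t)) := by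
    simp only [slope_def_module, Prod.mk_sub_mk, Prod.smul_mk]
    simp only [← RCLike.real_smul_eq_coe_smul]
  rw [SetLike.mem_coe, h2]
  exact L.graph.smul_mem _ (L.graph.sub_mem (hxy r hr.1) (hxy t ht))

omit [CompleteSpace E] in
/-- If `v' = Lv + f` on `[a, b]` then `v^(k)` takes values in `D(L)` and
`v^(k+1) = L v^(k) + f^(k)` there. -/
theorem iteratedDeriv_mem_graph (hL : IsClosed (L.graph : Set (E × E))) {v f : ℝ → E} {p : ℕ}
    {a b : ℝ} (hab : a < b) {U : Set ℝ} (hU : IsOpen U) (hUab : Icc a b ⊆ U)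
    (hv : ContDiffOn ℝ (p + 1 : ℕ) v U) (hf : ContDiffOn ℝ p f U)
    (h0 : ∀ t ∈ Icc a b, (v t, iteratedDeriv 1 v t - f t) ∈ L.graph) {k : ℕ} (hk : k ≤ p) :
    ∀ t ∈ Icc a b, (iteratedDeriv k v t, iteratedDeriv (k + 1) v t - iteratedDeriv k f t)
      ∈ L.graph := by
  induction k with
  | zero => simpa using h0
  | succ k ih =>
    intro t ht
    exact hasDerivWithinAt_mem_graph hL (uniqueDiffOn_Icc hab t ht) ht (ih (by omega))
      (hasDerivAt_iteratedDeriv hU hv (by omega) (hUab ht)).hasDerivWithinAt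
      ((hasDerivAt_iteratedDeriv hU hv (by omega) (hUab ht)).sub
        (hasDerivAt_iteratedDeriv hU hf (by omega) (hUab ht))).hasDerivWithinAt

/-- The Taylor polynomial of a solution of `u' = Lu + f` in terms of `φ`-functions. With
`w k = u^(k)(t)` and `f k = f^(k)(t)`, so that `w (k+1) = L (w k) + f k`, the recurrence
`w k / k! = φ_k(τL) w_k - τ φ_{k+1}(τL) L w_k` makes the sum telescope. -/
theorem IsGenerator.sum_taylor_eq (hL : IsGenerator S L) {w f : ℕ → E} {τ : ℝ} (hτ : 0 ≤ τ)
    (n : ℕ) (hw : ∀ k ≤ n + 1, (w k, w (k + 1) - f k) ∈ L.graph) :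
    ∑ k ∈ Finset.range (n + 2), (τ ^ k / (k.factorial : ℝ)) • w k =
      w 0 + τ • phi S 1 τ (w 1) + ∑ q ∈ Finset.range n, τ ^ (q + 2) • phi S (q + 2) τ (f (q + 1))
        - τ ^ (n + 2) • phi S (n + 2) τ (w (n + 2) - f (n + 1)) := by
  induction n with
  | zero =>
    rw [hL.phi_eq (hw 1 le_rfl) hτ 1]
    simp only [Finset.sum_range_succ, Finset.sum_range_zero, zero_add, pow_zero,
      Nat.factorial_zero, Nat.cast_one, div_one, one_smul, pow_one, Nat.factorial_one, inv_one,
      smul_add, smul_smul, add_zero, sq]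
    abel
  | succ n ih =>
    rw [Finset.sum_range_succ, ih fun k hk => hw k (by omega), Finset.sum_range_succ]
    obtain ⟨B, _, _, hB⟩ := exists_clm_phi S (n + 2) τ
    have hB' := (hB τ ⟨hτ, le_rfl⟩).1
    have h1 := hL.phi_eq (hw (n + 2) le_rfl) hτ (n + 2)
    rw [hB'] at h1
    have h2 : (τ ^ (n + 2) / ((n + 2).factorial : ℝ)) • w (n + 2) =
        τ ^ (n + 2) • B τ (w (n + 2)) -
          τ ^ (n + 1 + 2) • phi S (n + 1 + 2) τ (w (n + 1 + 2) - f (n + 1 + 1)) := by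
      rw [h1, smul_add, smul_smul, smul_smul, div_eq_mul_inv]
      rw [show n + 2 + 1 = n + 1 + 2 by ring, show τ ^ (n + 2) * τ = τ ^ (n + 1 + 2) by ring]
      abel
    rw [h2]
    simp only [hB', map_sub, smul_sub]
    abel

end Solution

/-! ### Expansion of the nonlinearity along the solution -/

section Nonlinearity

variable {𝕜 : Type*} [RCLike 𝕜] {E : Type*} [NormedAddCommGroup E] [NormedSpace ℝ E]
  [NormedSpace 𝕜 E] [IsScalarTower ℝ 𝕜 E]

omit [NormedSpace ℝ E] [IsScalarTower ℝ 𝕜 E] in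
theorem isOpen_strip (u : ℝ → E) (t₀ T ρ : ℝ) : IsOpen (strip u t₀ T ρ) := by
  have : strip u t₀ T ρ = ⋃ t ∈ Icc t₀ T, Metric.ball (u t) ρ := by
    ext x; simp [strip, dist_eq_norm]
  rw [this]
  exact isOpen_biUnion fun _ _ => Metric.isOpen_ball

/-- The `r`-linear map `(l! r!)⁻¹ (d/dt)^l N^(r)(v(t))`, set to `0` outside `1 ≤ r`,
`l + r ≤ p`: the coefficient of `s^l` in the Taylor polynomial of `N^(r)(v(t+s)) / r!`. -/
noncomputable def taylorCoeff (N : E → E) (v : ℝ → E) (p : ℕ) (t : ℝ) (l r : ℕ) :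
    ContinuousMultilinearMap 𝕜 (fun _ : Fin r => E) E :=
  if 1 ≤ r ∧ l + r ≤ p then
    ((r.factorial : ℝ)⁻¹ * (l.factorial : ℝ)⁻¹) •
      iteratedDeriv l (fun s => iteratedFDeriv 𝕜 r N (v s)) t
  else 0

variable {N : E → E} {Ω : Set E} {v : ℝ → E} {p : ℕ} {a b : ℝ}

/-- Two-variable Taylor expansion of `N(v(t+s)+e)-N(v(t+s))` at `(s, e) = (0, 0)`. -/
theorem exists_taylorCoeff_bound (hΩ : IsOpen Ω) (hN : ContDiffOn 𝕜 (p + 1 : ℕ) N Ω)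
    (hv : ContDiff ℝ (p + 1 : ℕ) v) {C₀ ρ : ℝ}
    (hC₀ : ∀ x ∈ Ω, ‖iteratedFDeriv 𝕜 (p + 1) N x‖ ≤ C₀)
    (hΩv : ∀ t ∈ Icc a b, ∀ e : E, ‖e‖ < ρ → v t + e ∈ Ω) (hρ : 0 < ρ) :
    ∃ C : ℝ, 0 ≤ C ∧ ∀ t ∈ Icc a b,
      (∀ l r, ‖taylorCoeff (𝕜 := 𝕜) N v p t l r‖ ≤ C) ∧
      ∀ s ∈ Icc 0 (b - t), ∀ e : E, ‖e‖ < ρ →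
        ‖N (v (t + s) + e) - N (v (t + s)) - ∑ l ∈ Finset.range p, ∑ r ∈ Finset.range p,
          s ^ l • taylorCoeff (𝕜 := 𝕜) N v p t l (r + 1) (fun _ => e)‖
            ≤ C * (s + ‖e‖) ^ (p + 1) := by
  have hU : IsOpen (v ⁻¹' Ω) := hΩ.preimage hv.continuous
  have hsub : Icc a b ⊆ v ⁻¹' Ω := fun t ht => by
    simpa using hΩv t ht 0 (by simpa using hρ)
  have h1 : ∀ r : ℕ, ∃ C : ℝ, 0 ≤ C ∧ (r < p → ∀ k ≤ p - r, ∀ t ∈ Icc a b,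
      ‖iteratedDeriv k (fun s => iteratedFDeriv 𝕜 (r + 1) N (v s)) t‖ ≤ C ∧
      ∀ s ∈ Icc t b, ‖iteratedFDeriv 𝕜 (r + 1) N (v s) - ∑ l ∈ Finset.range k,
        ((s - t) ^ l / (l.factorial : ℝ)) •
          iteratedDeriv l (fun s => iteratedFDeriv 𝕜 (r + 1) N (v s)) t‖ ≤ C * (s - t) ^ k) := by
    intro r
    by_cases hr : r < p
    · obtain ⟨C, hC0, hC⟩ := exists_taylor_bound hU
        (contDiffOn_iteratedFDeriv_comp (m := p - r) (r := r + 1) hΩ hN (by omega) hv) hsub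
      exact ⟨C, hC0, fun _ => hC⟩
    · exact ⟨0, le_rfl, fun h => absurd h hr⟩
  choose C hC0 hC using h1
  have hle : ∀ r < p, C r ≤ ∑ r ∈ Finset.range p, C r := fun r hr =>
    Finset.single_le_sum (fun i _ => hC0 i) (Finset.mem_range.2 hr)
  have hsum0 : 0 ≤ ∑ r ∈ Finset.range p, C r := Finset.sum_nonneg fun i _ => hC0 i
  have hfac : ∀ k : ℕ, ((k.factorial : ℝ)⁻¹) ≤ 1 := fun k =>
    inv_le_one_of_one_le₀ (by exact_mod_cast k.factorial_pos)
  refine ⟨|C₀| + ∑ r ∈ Finset.range p, C r, by positivity, fun t ht => ⟨fun l r => ?_, ?_⟩⟩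
  · rw [taylorCoeff]
    split_ifs with hlr
    · obtain ⟨r, rfl⟩ : ∃ r', r = r' + 1 := ⟨r - 1, by omega⟩
      rw [norm_smul, Real.norm_of_nonneg (by positivity)]
      calc _ ≤ 1 * ∑ r ∈ Finset.range p, C r := by
            refine mul_le_mul (mul_le_one₀ (hfac _) (by positivity) (hfac _))
              (((hC r (by omega) l (by omega) t ht).1).trans (hle r (by omega)))
              (norm_nonneg _) zero_le_one
        _ ≤ _ := by rw [one_mul]; exact le_add_of_nonneg_left (abs_nonneg _)
    · rw [norm_zero]; positivity
  intro s hs e he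
  have hts : t + s ∈ Icc a b := ⟨by linarith [ht.1, hs.1], by linarith [hs.2]⟩
  have hse : 0 ≤ s := hs.1
  -- Taylor expansion in `e` at the point `v (t + s)`
  have h2 := norm_sub_taylor_le hΩ hN (C := |C₀|) (x := v (t + s)) (e := e)
    (fun x hx => (hC₀ x hx).trans (le_abs_self _)) (fun σ hσ => by
      refine hΩv _ hts _ ?_
      rw [norm_smul, Real.norm_of_nonneg hσ.1]
      exact (mul_le_of_le_one_left (norm_nonneg _) hσ.2).trans_lt he)
  -- Taylor expansion of its coefficients in `s`
  have h3 : ∀ r ∈ Finset.range p,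
      ‖(((r + 1).factorial : ℝ)⁻¹) • iteratedFDeriv 𝕜 (r + 1) N (v (t + s)) (fun _ => e) -
        ∑ l ∈ Finset.range p, s ^ l • taylorCoeff (𝕜 := 𝕜) N v p t l (r + 1) (fun _ => e)‖
          ≤ C r * (s + ‖e‖) ^ (p + 1) := by
    intro r hr
    rw [Finset.mem_range] at hr
    have h4 := (hC r hr (p - r) le_rfl t ht).2 (t + s) ⟨by linarith, hts.2⟩
    rw [add_sub_cancel_left] at h4
    have h5 : ∑ l ∈ Finset.range p, s ^ l • taylorCoeff (𝕜 := 𝕜) N v p t l (r + 1)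
          (fun _ => e) =
        (((r + 1).factorial : ℝ)⁻¹) • (∑ l ∈ Finset.range (p - r), (s ^ l / (l.factorial : ℝ)) •
          iteratedDeriv l (fun s => iteratedFDeriv 𝕜 (r + 1) N (v s)) t) (fun _ => e) := by
      rw [← Finset.sum_subset (Finset.range_subset_range.2 (Nat.sub_le p r))]
      · rw [sum_apply, Finset.smul_sum]
        refine Finset.sum_congr rfl fun l hl => ?_
        rw [Finset.mem_range] at hl
        rw [taylorCoeff, if_pos ⟨by omega, by omega⟩]
        simp only [smul_apply, smul_smul]
        congr 1; ring
      · intro l _ hl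
        rw [Finset.mem_range] at hl
        rw [taylorCoeff, if_neg (by omega)]
        simp
    rw [h5, ← smul_sub, ← sub_apply, norm_smul,
      Real.norm_of_nonneg (by positivity)]
    calc _ ≤ 1 * ((C r * s ^ (p - r)) * ‖e‖ ^ (r + 1)) := by
          refine mul_le_mul (hfac _) ?_ (norm_nonneg _) zero_le_one
          refine (ContinuousMultilinearMap.le_of_opNorm_le h4 _).trans (le_of_eq ?_)
          rw [Finset.prod_const, Finset.card_univ, Fintype.card_fin]
      _ ≤ C r * ((s + ‖e‖) ^ (p - r) * (s + ‖e‖) ^ (r + 1)) := by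
          have := norm_nonneg e
          rw [one_mul, mul_assoc]
          refine mul_le_mul_of_nonneg_left ?_ (hC0 r)
          gcongr <;> linarith
      _ = _ := by rw [← pow_add]; congr 2; omega
  rw [Finset.sum_range_succ'] at h2
  simp only [Nat.factorial_zero, Nat.cast_one, inv_one, one_smul,
    iteratedFDeriv_zero_apply] at h2
  rw [Finset.sum_comm, add_mul, Finset.sum_mul]
  have h6 := norm_sum_le_of_le _ h3
  rw [Finset.sum_sub_distrib] at h6
  have h7 : |C₀| * ‖e‖ ^ (p + 1) ≤ |C₀| * (s + ‖e‖) ^ (p + 1) := by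
    gcongr; linarith
  refine le_trans (le_of_eq ?_) ((norm_add_le _ _).trans (add_le_add (h2.trans h7) h6))
  congr 1; abel

end Nonlinearity

/-! ### Uniform expansions at points of the solution -/

section Expansion

variable {𝕜 : Type*} [RCLike 𝕜] {E : Type*} [NormedAddCommGroup E] [NormedSpace ℝ E]
  [NormedSpace 𝕜 E] [IsScalarTower ℝ 𝕜 E]

/-- The elementary maps `h^(1+l) (l! r!)⁻¹ (d/dt)^l N^(r)(v(t))`. -/
noncomputable def elemMap (N : E → E) (v : ℝ → E) (p : ℕ) (t h : ℝ) (l r : ℕ) :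
    ContinuousMultilinearMap 𝕜 (fun _ : Fin r => E) E :=
  h ^ (1 + l) • taylorCoeff N v p t l r

/-- The elementary vectors `h^k (N ∘ v)^(k-1)(t)` for `2 ≤ k ≤ p`, and `0` for other `k`. -/
noncomputable def elemVec (N : E → E) (v : ℝ → E) (p : ℕ) (t h : ℝ) (k : ℕ) : E :=
  if 2 ≤ k ∧ k ≤ p then h ^ k • iteratedDeriv (k - 1) (fun s => N (v s)) t else 0

/-- The expansions on which the local error analysis rests, uniformly for `t ∈ [t₀, T]`. The
curve `v` extends the solution to `[t₀, T + δ]`, since nodes `c_i > 1` may lead out of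
`[t₀, T]`; `N` is controlled in the tube of radius `ρ` around `v`. -/
structure UniformExpansion (L : E →ₗ.[𝕜] E) (N : E → E) (v : ℝ → E) (p : ℕ)
    (t₀ T δ ρ C : ℝ) : Prop where
  delta_pos : 0 < δ
  rho_pos : 0 < ρ
  nonneg : 0 ≤ C
  mem_graph : ∀ t ∈ Icc t₀ T, ∀ k ≤ p, (iteratedDeriv k v t,
    iteratedDeriv (k + 1) v t - iteratedDeriv k (fun s => N (v s)) t) ∈ L.graph
  norm_deriv_sub : ∀ t ∈ Icc t₀ T,
    ‖iteratedDeriv (p + 1) v t - iteratedDeriv p (fun s => N (v s)) t‖ ≤ C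
  taylor_sol : ∀ t ∈ Icc t₀ T, ∀ s ∈ Icc 0 δ, ‖v (t + s) - ∑ k ∈ Finset.range (p + 1),
    (s ^ k / (k.factorial : ℝ)) • iteratedDeriv k v t‖ ≤ C * s ^ (p + 1)
  taylor_comp : ∀ t ∈ Icc t₀ T, ∀ s ∈ Icc 0 δ, ‖N (v (t + s)) - ∑ k ∈ Finset.range p,
    (s ^ k / (k.factorial : ℝ)) • iteratedDeriv k (fun s => N (v s)) t‖ ≤ C * s ^ p
  norm_deriv_comp : ∀ t ∈ Icc t₀ T, ∀ k ≤ p, ‖iteratedDeriv k (fun s => N (v s)) t‖ ≤ C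
  norm_coeff : ∀ t ∈ Icc t₀ T, ∀ l r, ‖taylorCoeff (𝕜 := 𝕜) N v p t l r‖ ≤ C
  taylor_map : ∀ t ∈ Icc t₀ T, ∀ s ∈ Icc 0 δ, ∀ e : E, ‖e‖ < ρ →
    ‖N (v (t + s) + e) - N (v (t + s)) - ∑ l ∈ Finset.range p, ∑ r ∈ Finset.range p,
      s ^ l • taylorCoeff (𝕜 := 𝕜) N v p t l (r + 1) (fun _ => e)‖ ≤ C * (s + ‖e‖) ^ (p + 1)
  lipschitz : ∀ t ∈ Icc t₀ T, ∀ s ∈ Icc 0 δ, ∀ e e' : E, ‖e‖ < ρ → ‖e'‖ < ρ →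
    ‖N (v (t + s) + e) - N (v (t + s) + e')‖ ≤ C * ‖e - e'‖

theorem exists_uniformExpansion [CompleteSpace E] {S : C0Semigroup 𝕜 E} {L : E →ₗ.[𝕜] E}
    (hL : IsGenerator S L) {N : E → E} {u₀ : E} {t₀ T : ℝ} (hT : t₀ < T) {u : ℝ → E}
    (hu : IsSolution L N u₀ t₀ T u) {p : ℕ} (hreg : Regular 𝕜 N u t₀ T (p + 1)) :
    ∃ (v : ℝ → E) (δ ρ C : ℝ), EqOn v u (Icc t₀ T) ∧
      UniformExpansion L N v p t₀ T δ ρ C := by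
  obtain ⟨⟨hu1, -⟩, ρ, hρ, hN, C₀, hC₀⟩ := hreg
  obtain ⟨v, hv, hvu⟩ := exists_contDiff_extension hT (p + 1) u hu1
  set Ω := strip u t₀ T ρ with hΩdef
  have hΩ : IsOpen Ω := isOpen_strip u t₀ T ρ
  obtain ⟨δ', hδ', hvδ⟩ := Metric.continuousAt_iff.1 (hv.continuous.continuousAt (x := T))
    (ρ / 2) (by positivity)
  have hmargin : ∀ t ∈ Icc t₀ (T + δ' / 2), ∀ e : E, ‖e‖ < ρ / 2 → v t + e ∈ Ω := by
    intro t ht e he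
    rcases le_total t T with h | h
    · refine ⟨t, ⟨ht.1, h⟩, ?_⟩
      rw [hvu ⟨ht.1, h⟩, add_sub_cancel_left]
      linarith
    · refine ⟨T, ⟨hT.le, le_rfl⟩, ?_⟩
      have h1 := hvδ (x := t) (by
        rw [Real.dist_eq, abs_of_nonneg (by linarith)]
        linarith [ht.2])
      rw [dist_eq_norm, hvu ⟨hT.le, le_rfl⟩] at h1
      calc ‖v t + e - u T‖ = ‖(v t - u T) + e‖ := by congr 1; abel
        _ ≤ _ := norm_add_le _ _
        _ < ρ := by linarith
  have hU : IsOpen (v ⁻¹' Ω) := hΩ.preimage hv.continuous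
  have hsub : Icc t₀ (T + δ' / 2) ⊆ v ⁻¹' Ω := fun t ht => by
    simpa using hmargin t ht 0 (by simpa using hρ)
  have hsub' : Icc t₀ T ⊆ Icc t₀ (T + δ' / 2) := Icc_subset_Icc_right (by linarith)
  have hf : ContDiffOn ℝ (p + 1 : ℕ) (fun s => N (v s)) (v ⁻¹' Ω) := fun t ht =>
    (((hN.contDiffAt (hΩ.mem_nhds ht)).restrict_scalars ℝ).comp t hv.contDiffAt).contDiffWithinAt
  obtain ⟨C₁, hC₁, h1⟩ := exists_taylor_bound hU hv.contDiffOn hsub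
  obtain ⟨C₂, hC₂, h2⟩ := exists_taylor_bound hU hf hsub
  obtain ⟨C₃, hC₃, h3⟩ := exists_taylorCoeff_bound hΩ hN hv (hC₀ (p + 1) le_rfl) hmargin
    (by positivity)
  have hδt : ∀ t ∈ Icc t₀ T, ∀ s ∈ Icc 0 (δ' / 2), t + s ∈ Icc t (T + δ' / 2) := fun t ht s hs =>
    ⟨by linarith [hs.1], by linarith [hs.2, ht.2]⟩
  have hCle : 0 ≤ |C₀| := abs_nonneg _
  refine ⟨v, δ' / 2, ρ / 2, |C₀| + C₁ + C₂ + C₃, hvu, ⟨by positivity, by positivity,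
    by positivity, ?_, ?_, ?_, ?_, ?_, ?_, ?_, ?_⟩⟩
  · intro t ht k hk
    refine iteratedDeriv_mem_graph hL.isClosed_graph hT hU (hsub'.trans hsub) hv.contDiffOn
      (hf.of_le (by exact_mod_cast Nat.le_succ p)) (fun r hr => ?_) hk t ht
    obtain ⟨y, hy, hd⟩ := hu.2 r hr
    have hd1 : HasDerivWithinAt v (iteratedDeriv 1 v r) (Icc t₀ T) r := by
      rw [iteratedDeriv_one]
      exact ((hv.differentiable (by simp)) r).hasDerivAt.hasDerivWithinAt
    have hd2 : HasDerivWithinAt v (y + N (u r)) (Icc t₀ T) r :=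
      hd.congr hvu (hvu hr)
    rw [(uniqueDiffOn_Icc hT r hr).eq_deriv _ hd1 hd2, hvu hr, add_sub_cancel_right]
    exact hy
  · intro t ht
    have e1 := (h1 (p + 1) le_rfl t (hsub' ht)).1
    have e2 := (h2 p (Nat.le_succ p) t (hsub' ht)).1
    refine (norm_sub_le _ _).trans ?_
    linarith
  · intro t ht s hs
    have e1 := (h1 (p + 1) le_rfl t (hsub' ht)).2 (t + s) (hδt t ht s hs)
    rw [add_sub_cancel_left] at e1
    refine e1.trans (mul_le_mul_of_nonneg_right (by linarith) (pow_nonneg hs.1 _))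
  · intro t ht s hs
    have e1 := (h2 p (Nat.le_succ p) t (hsub' ht)).2 (t + s) (hδt t ht s hs)
    rw [add_sub_cancel_left] at e1
    refine e1.trans (mul_le_mul_of_nonneg_right (by linarith) (pow_nonneg hs.1 _))
  · intro t ht k hk
    have e2 := (h2 k (by omega) t (hsub' ht)).1
    linarith
  · intro t ht l r
    have e3 := (h3 t (hsub' ht)).1 l r
    linarith
  · intro t ht s hs e he
    refine ((h3 t (hsub' ht)).2 s ⟨hs.1, by linarith [hs.2, ht.2]⟩ e he).trans ?_
    have := hs.1
    exact mul_le_mul_of_nonneg_right (by linarith) (by positivity)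
  · intro t ht s hs e e' he he'
    have hts : t + s ∈ Icc t₀ (T + δ' / 2) :=
      ⟨ht.1.trans (hδt t ht s hs).1, (hδt t ht s hs).2⟩
    have e1 := norm_sub_taylor_le hΩ (n := 1) (hN.of_le (by exact_mod_cast Nat.le_add_left 1 p))
      (C := |C₀|) (x := v (t + s) + e') (e := e - e')
      (fun x hx => (hC₀ 1 (by omega) x hx).trans (le_abs_self _)) (fun σ hσ => by
        have h4 := (convex_ball (0 : E) (ρ / 2)).add_smul_sub_mem
          (x := e') (y := e) (by simpa using he') (by simpa using he) hσ
        rw [add_assoc]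
        exact hmargin _ hts _ (by simpa using h4))
    simp only [Finset.range_one, Finset.sum_singleton, Nat.factorial_zero, Nat.cast_one, inv_one,
      one_smul, iteratedFDeriv_zero_apply, pow_one] at e1
    rw [add_add_sub_cancel] at e1
    exact e1.trans (mul_le_mul_of_nonneg_right (by linarith) (norm_nonneg _))

variable {L : E →ₗ.[𝕜] E} {N : E → E} {v : ℝ → E} {p : ℕ} {t₀ T δ ρ C : ℝ}

theorem UniformExpansion.scaled (H : UniformExpansion L N v p t₀ T δ ρ C) {t : ℝ}
    (ht : t ∈ Icc t₀ T) {h : ℝ} (hh : 0 ≤ h) :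
    Scaled (𝕜 := 𝕜) C h (elemMap N v p t h) (elemVec N v p t h) := by
  have hC := H.nonneg
  refine ⟨fun l r => ?_, fun k => ?_⟩
  · rw [elemMap, norm_smul, Real.norm_of_nonneg (by positivity), mul_comm]
    exact mul_le_mul_of_nonneg_right (H.norm_coeff t ht l r) (by positivity)
  · rw [elemVec]
    split_ifs with hk
    · rw [norm_smul, Real.norm_of_nonneg (by positivity), mul_comm]
      exact mul_le_mul_of_nonneg_right (H.norm_deriv_comp t ht _ (by omega)) (by positivity)
    · rw [norm_zero]; positivity

/-- Expansion of `h (N(v(t+ch)+e) - N(v(t)))` for perturbations `e` close to some `Y = O(h)`. -/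
theorem UniformExpansion.exists_norm_defect_le (H : UniformExpansion L N v p t₀ T δ ρ C)
    (hp : 1 ≤ p) {c D : ℝ} (hc : 0 ≤ c) (hD : 0 ≤ D) :
    ∃ C' : ℝ, 0 ≤ C' ∧ ∀ᶠ h in 𝓝[>] (0 : ℝ), ∀ t ∈ Icc t₀ T, ∀ e Y : E,
      ‖Y‖ ≤ D * h → ‖e - Y‖ ≤ D * h ^ p →
      ‖h • (N (v (t + c * h) + e) - N (v t)) -
          ∑ q ∈ Finset.range (p - 1),
            (c ^ (q + 1) / ((q + 1).factorial : ℝ)) • elemVec N v p t h (q + 2) -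
          ∑ l ∈ Finset.range p, ∑ r ∈ Finset.range p,
            c ^ l • elemMap (𝕜 := 𝕜) N v p t h l (r + 1) (fun _ => Y)‖ ≤ C' * h ^ (p + 1) := by
  have hC := H.nonneg
  refine ⟨C * (c + 2 * D) ^ (p + 1) +
    (∑ l ∈ Finset.range p, ∑ r ∈ Finset.range p,
      c ^ l * (C * ((r + 1 : ℕ) : ℝ) * (2 * D) ^ r * D)) + C * c ^ p, by positivity, ?_⟩
  have hδ : ∀ᶠ h in 𝓝[>] (0 : ℝ), c * h < δ :=
    nhdsWithin_le_nhds ((Continuous.tendsto' (f := fun h : ℝ => c * h) (by fun_prop) 0 0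
      (by simp)).eventually_lt_const H.delta_pos)
  have hρ : ∀ᶠ h in 𝓝[>] (0 : ℝ), 2 * D * h < ρ :=
    nhdsWithin_le_nhds ((Continuous.tendsto' (f := fun h : ℝ => 2 * D * h) (by fun_prop) 0 0
      (by simp)).eventually_lt_const H.rho_pos)
  filter_upwards [hδ, hρ, Ioc_mem_nhdsGT zero_lt_one] with h hδ hρ hh t ht e Y hY heY
  obtain ⟨hh0, hh1⟩ := hh
  have hs : c * h ∈ Icc 0 δ := ⟨by positivity, hδ.le⟩
  have hpow : h ^ p ≤ h := pow_le_of_le_one hh0.le hh1 (by omega)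
  have he : ‖e‖ ≤ 2 * D * h := by
    calc ‖e‖ = ‖(e - Y) + Y‖ := by rw [sub_add_cancel]
      _ ≤ D * h ^ p + D * h := (norm_add_le _ _).trans (add_le_add heY hY)
      _ ≤ D * h + D * h := by gcongr
      _ = _ := by ring
  have hY' : ‖Y‖ ≤ 2 * D * h := hY.trans (by nlinarith [mul_nonneg hD hh0.le])
  -- the first part: Taylor expansion in the perturbation
  have e1 := H.taylor_map t ht _ hs e (he.trans_lt hρ)
  have b1 : ‖h • (N (v (t + c * h) + e) - N (v (t + c * h)) - ∑ l ∈ Finset.range p,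
      ∑ r ∈ Finset.range p, (c * h) ^ l • taylorCoeff (𝕜 := 𝕜) N v p t l (r + 1) (fun _ => e))‖
      ≤ C * (c + 2 * D) ^ (p + 1) * h ^ (p + 1) := by
    rw [norm_smul, Real.norm_of_nonneg hh0.le]
    calc _ ≤ 1 * (C * (c * h + 2 * D * h) ^ (p + 1)) := by
          refine mul_le_mul hh1 (e1.trans ?_) (norm_nonneg _) zero_le_one
          gcongr
      _ = _ := by rw [← add_mul, mul_pow]; ring
  -- the second part: replacing `e` by `Y`
  have b2 : ‖∑ l ∈ Finset.range p, ∑ r ∈ Finset.range p,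
      c ^ l • (elemMap (𝕜 := 𝕜) N v p t h l (r + 1) (fun _ => e) -
        elemMap (𝕜 := 𝕜) N v p t h l (r + 1) (fun _ => Y))‖ ≤
      (∑ l ∈ Finset.range p, ∑ r ∈ Finset.range p,
        c ^ l * (C * ((r + 1 : ℕ) : ℝ) * (2 * D) ^ r * D)) * h ^ (p + 1) := by
    simp only [Finset.sum_mul]
    refine norm_sum_le_of_le _ fun l _ => norm_sum_le_of_le _ fun r _ => ?_
    rw [norm_smul, Real.norm_of_nonneg (by positivity), mul_assoc]
    refine mul_le_mul_of_nonneg_left ?_ (by positivity)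
    refine (ContinuousMultilinearMap.norm_image_sub_le _ _ _).trans ?_
    have n1 : ‖elemMap (𝕜 := 𝕜) N v p t h l (r + 1)‖ ≤ C * h := by
      refine ((H.scaled ht hh0.le).1 l (r + 1)).trans ?_
      gcongr
      exact pow_le_of_le_one hh0.le hh1 (by omega)
    have n2 : max ‖fun _ : Fin (r + 1) => e‖ ‖fun _ : Fin (r + 1) => Y‖ ≤ 2 * D := by
      have : 2 * D * h ≤ 2 * D := mul_le_of_le_one_right (by positivity) hh1
      exact max_le ((pi_norm_const_le e).trans (he.trans this))
        ((pi_norm_const_le Y).trans (hY'.trans this))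
    have n3 : ‖(fun _ : Fin (r + 1) => e) - (fun _ : Fin (r + 1) => Y)‖ ≤ D * h ^ p :=
      (pi_norm_const_le (e - Y)).trans heY
    rw [Fintype.card_fin, Nat.add_sub_cancel]
    calc _ ≤ (C * h) * ((r + 1 : ℕ) : ℝ) * (2 * D) ^ r * (D * h ^ p) := by
          gcongr
      _ = _ := by ring
  -- the third part: Taylor expansion along the solution
  have e3 := H.taylor_comp t ht _ hs
  have b3 : ‖h • (N (v (t + c * h)) - ∑ k ∈ Finset.range p,
      ((c * h) ^ k / (k.factorial : ℝ)) • iteratedDeriv k (fun s => N (v s)) t)‖ ≤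
      C * c ^ p * h ^ (p + 1) := by
    rw [norm_smul, Real.norm_of_nonneg hh0.le]
    calc _ ≤ h * (C * (c * h) ^ p) := by gcongr
      _ = _ := by rw [mul_pow]; ring
  rw [add_mul, add_mul]
  refine le_trans (le_of_eq ?_) ((norm_add₃_le).trans (add_le_add (add_le_add b1 b2) b3))
  congr 1
  have a1 : h • ∑ k ∈ Finset.range p, ((c * h) ^ k / (k.factorial : ℝ)) •
      iteratedDeriv k (fun s => N (v s)) t = h • N (v t) + ∑ q ∈ Finset.range (p - 1),
        (c ^ (q + 1) / ((q + 1).factorial : ℝ)) • elemVec N v p t h (q + 2) := by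
    obtain ⟨n, rfl⟩ : ∃ n, p = n + 1 := ⟨p - 1, by omega⟩
    rw [Finset.sum_range_succ', smul_add, add_comm, Nat.add_sub_cancel]
    congr 1
    · simp
    · rw [Finset.smul_sum]
      refine Finset.sum_congr rfl fun q hq => ?_
      rw [Finset.mem_range] at hq
      rw [elemVec, if_pos ⟨by omega, by omega⟩, smul_smul, smul_smul]
      congr 1
      rw [mul_pow]; ring
  have a2 : h • ∑ l ∈ Finset.range p, ∑ r ∈ Finset.range p, (c * h) ^ l •
      taylorCoeff (𝕜 := 𝕜) N v p t l (r + 1) (fun _ => e) = ∑ l ∈ Finset.range p,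
        ∑ r ∈ Finset.range p, c ^ l • elemMap (𝕜 := 𝕜) N v p t h l (r + 1) (fun _ => e) := by
    simp only [Finset.smul_sum, elemMap, smul_apply, smul_smul]
    refine Finset.sum_congr rfl fun l _ => Finset.sum_congr rfl fun r _ => ?_
    congr 1
    rw [mul_pow]; ring
  simp only [smul_sub, Finset.sum_sub_distrib, a1, a2]
  abel

/-- Expansion of the solution over a step of length `ch`. -/
theorem UniformExpansion.exists_norm_solution_le [CompleteSpace E] {S : C0Semigroup 𝕜 E}
    (H : UniformExpansion L N v p t₀ T δ ρ C) (hL : IsGenerator S L) (hp : 1 ≤ p) {c : ℝ}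
    (hc : 0 ≤ c) :
    ∃ C' : ℝ, 0 ≤ C' ∧ ∀ᶠ h in 𝓝[>] (0 : ℝ), ∀ t ∈ Icc t₀ T,
      ‖v (t + c * h) - v t - (c * h) • phi S 1 (c * h) (iteratedDeriv 1 v t) -
        ∑ q ∈ Finset.range (p - 1),
          c ^ (q + 2) • phi S (q + 2) (c * h) (elemVec N v p t h (q + 2))‖
        ≤ C' * h ^ (p + 1) := by
  have hC := H.nonneg
  obtain ⟨B, C₁, hC₁, hB⟩ := exists_clm_phi S (p + 1) c
  refine ⟨C * c ^ (p + 1) + c ^ (p + 1) * (C₁ * C), by positivity, ?_⟩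
  have hδ : ∀ᶠ h in 𝓝[>] (0 : ℝ), c * h < δ :=
    nhdsWithin_le_nhds ((Continuous.tendsto' (f := fun h : ℝ => c * h) (by fun_prop) 0 0
      (by simp)).eventually_lt_const H.delta_pos)
  filter_upwards [hδ, Ioc_mem_nhdsGT zero_lt_one] with h hδ hh t ht
  obtain ⟨hh0, hh1⟩ := hh
  have hτ : 0 ≤ c * h := by positivity
  have e1 := H.taylor_sol t ht (c * h) ⟨hτ, hδ.le⟩
  have hB1 := hB (c * h) ⟨hτ, mul_le_of_le_one_right hc hh1⟩
  have e2 : ‖(c * h) ^ (p + 1) • phi S (p + 1) (c * h) (iteratedDeriv (p + 1) v t -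
      iteratedDeriv p (fun s => N (v s)) t)‖ ≤ (c * h) ^ (p + 1) * (C₁ * C) := by
    rw [norm_smul, Real.norm_of_nonneg (by positivity), hB1.1]
    gcongr
    exact ((B _).le_of_opNorm_le hB1.2 _).trans
      (mul_le_mul_of_nonneg_left (H.norm_deriv_sub t ht) hC₁)
  obtain ⟨n, rfl⟩ : ∃ n, p = n + 1 := ⟨p - 1, by omega⟩
  have key := hL.sum_taylor_eq hτ n (w := fun k => iteratedDeriv k v t)
    (f := fun k => iteratedDeriv k (fun s => N (v s)) t) (H.mem_graph t ht)
  have hv : ∑ q ∈ Finset.range n, (c * h) ^ (q + 2) • phi S (q + 2) (c * h)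
      (iteratedDeriv (q + 1) (fun s => N (v s)) t) = ∑ q ∈ Finset.range n,
        c ^ (q + 2) • phi S (q + 2) (c * h) (elemVec N v (n + 1) t h (q + 2)) := by
    refine Finset.sum_congr rfl fun q hq => ?_
    rw [Finset.mem_range] at hq
    obtain ⟨B', _, _, hB'⟩ := exists_clm_phi S (q + 2) (c * h)
    rw [elemVec, if_pos ⟨by omega, by omega⟩]
    simp only [(hB' (c * h) ⟨hτ, le_rfl⟩).1, ContinuousLinearMap.map_smul_of_tower, smul_smul,
      mul_pow]
    rfl
  rw [hv] at key
  rw [key] at e1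
  have e3 := (norm_sub_le _ _).trans (add_le_add e1 e2)
  rw [mul_pow] at e3
  refine le_trans (le_of_eq ?_) (e3.trans (le_of_eq (by ring)))
  congr 1
  simp only [iteratedDeriv_zero, Nat.add_sub_cancel]
  abel

end Expansion

/-! ### Local error -/

section LocalError

variable {𝕜 : Type*} [RCLike 𝕜] {E : Type*} [NormedAddCommGroup E] [NormedSpace ℝ E]
  [NormedSpace 𝕜 E] {m : ℕ}

theorem stage_eq (M : Method 𝕜 m) (S : C0Semigroup 𝕜 E) (L : E →ₗ.[𝕜] E) (N : E → E) (h : ℝ)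
    (x : E) (i : Fin m) : stage M S L N h x i = rationalStep L N (M.Ri i) (M.c i * h) x +
      h • ∑ j ∈ Finset.univ.filter (fun j => j < i),
        (M.a i j).eval S h (N (stage M S L N h x j) - N x) := by
  rw [stage]
  congr 2
  refine Finset.sum_bij (fun j _ => j.castLE i.isLt.le) (fun j _ => ?_) (fun j _ j' _ hj => ?_)
    (fun j hj => ?_) (fun _ _ => rfl)
  · exact Finset.mem_filter.2 ⟨Finset.mem_univ _, j.isLt⟩
  · simpa [Fin.ext_iff] using hj
  · exact ⟨⟨j.val, (Finset.mem_filter.1 hj).2⟩, Finset.mem_univ _, rfl⟩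

variable [IsScalarTower ℝ 𝕜 E] [CompleteSpace E] {S : C0Semigroup 𝕜 E} {L : E →ₗ.[𝕜] E}
  {N : E → E} {v : ℝ → E} {p : ℕ} {t₀ T δ ρ C : ℝ}

/-- Expansion of one exponential update with perturbed stages `v(t+c_jh) + e_j`, `e_j ≈ Y_j`: the
defect is the sum of the leaf expressions and of the multilinear expressions in `Y`. The internal
stages and the final update are both of this form. -/
theorem UniformExpansion.exists_norm_update_le (H : UniformExpansion L N v p t₀ T δ ρ C)
    (hL : IsGenerator S L) (hp : 1 ≤ p) (M : Method 𝕜 m) (J : Finset (Fin m))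
    (α : Fin m → ExpCoeff 𝕜) {c D : ℝ} (hc : 0 ≤ c) (hD : 0 ≤ D) :
    ∃ C' : ℝ, 0 ≤ C' ∧ ∀ᶠ h in 𝓝[>] (0 : ℝ), ∀ t ∈ Icc t₀ T, ∀ e Y : Fin m → E,
      (∀ j ∈ J, ‖Y j‖ ≤ D * h) → (∀ j ∈ J, ‖e j - Y j‖ ≤ D * h ^ p) →
      ‖v t + (c * h) • phi S 1 (c * h) (iteratedDeriv 1 v t) +
          h • ∑ j ∈ J, (α j).eval S h (N (v (t + M.c j * h) + e j) - N (v t)) - v (t + c * h) -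
        (∑ q ∈ Finset.range (p - 1), (∑ j ∈ J, (M.c j ^ (q + 1) / ((q + 1).factorial : ℝ)) •
            (α j).eval S h (elemVec N v p t h (q + 2)) -
            c ^ (q + 2) • phi S (q + 2) (c * h) (elemVec N v p t h (q + 2))) +
          ∑ l ∈ Finset.range p, ∑ r ∈ Finset.range p, ∑ j ∈ J, M.c j ^ l •
            (α j).eval S h (elemMap (𝕜 := 𝕜) N v p t h l (r + 1) fun _ => Y j))‖
        ≤ C' * h ^ (p + 1) := by
  choose C₁ hC₁ h1 using fun j => H.exists_norm_defect_le hp (M.c_nonneg j) hD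
  obtain ⟨C₂, hC₂, h2⟩ := exists_norm_sum_eval_le S 1 J α (fun _ => 1)
  obtain ⟨C₃, hC₃, h3⟩ := H.exists_norm_solution_le hL hp hc
  refine ⟨C₂ * ∑ j, C₁ j + C₃, add_nonneg (mul_nonneg hC₂
    (Finset.sum_nonneg fun j _ => hC₁ j)) hC₃, ?_⟩
  filter_upwards [eventually_all.2 h1, h3, Ioc_mem_nhdsGT zero_lt_one] with h h1 h3 hh t ht e Y
    hY heY
  have e2 := h2 h ⟨hh.1.le, hh.2⟩ (fun j => h • (N (v (t + M.c j * h) + e j) - N (v t)) -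
      ∑ q ∈ Finset.range (p - 1),
        (M.c j ^ (q + 1) / ((q + 1).factorial : ℝ)) • elemVec N v p t h (q + 2) -
      ∑ l ∈ Finset.range p, ∑ r ∈ Finset.range p,
        M.c j ^ l • elemMap (𝕜 := 𝕜) N v p t h l (r + 1) (fun _ => Y j))
    ((∑ j, C₁ j) * h ^ (p + 1)) (fun j hj =>
      (h1 j t ht (e j) (Y j) (hY j hj) (heY j hj)).trans (mul_le_mul_of_nonneg_right
        (Finset.single_le_sum (fun j _ => hC₁ j) (Finset.mem_univ j))
        (pow_nonneg hh.1.le _)))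
  have e3 := h3 t ht
  have e4 := (norm_sub_le _ _).trans (add_le_add e2 e3)
  refine le_trans (le_of_eq ?_) (e4.trans (le_of_eq (by ring)))
  congr 1
  simp only [one_smul, ExpCoeff.eval_sub _ _ hh.1.le, ExpCoeff.eval_sum _ _ hh.1.le,
    ExpCoeff.eval_smul _ _ hh.1.le, Finset.sum_sub_distrib, Finset.smul_sum, smul_sub]
  have c1 : ∑ j ∈ J, ∑ q ∈ Finset.range (p - 1), (M.c j ^ (q + 1) / ((q + 1).factorial : ℝ)) •
      (α j).eval S h (elemVec N v p t h (q + 2)) =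
      ∑ q ∈ Finset.range (p - 1), ∑ j ∈ J, (M.c j ^ (q + 1) / ((q + 1).factorial : ℝ)) •
      (α j).eval S h (elemVec N v p t h (q + 2)) := Finset.sum_comm
  have c2 : ∑ j ∈ J, ∑ l ∈ Finset.range p, ∑ r ∈ Finset.range p, M.c j ^ l •
      (α j).eval S h (elemMap (𝕜 := 𝕜) N v p t h l (r + 1) fun _ => Y j) =
      ∑ l ∈ Finset.range p, ∑ r ∈ Finset.range p, ∑ j ∈ J, M.c j ^ l •
      (α j).eval S h (elemMap (𝕜 := 𝕜) N v p t h l (r + 1) fun _ => Y j) := by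
    rw [Finset.sum_comm]
    exact Finset.sum_congr rfl fun l _ => Finset.sum_comm
  rw [c1, c2]
  abel

/-- The rational approximations agree with `φ_1` on `v'(t)`, `t = t₀ + n h`, up to the required
order. -/
def RationalBound (M : Method 𝕜 m) (S : C0Semigroup 𝕜 E) (L : E →ₗ.[𝕜] E) (v : ℝ → E)
    (p : ℕ) (t₀ T h₀ C : ℝ) : Prop :=
  ∀ h ∈ Ioc 0 h₀, ∀ n : ℕ, t₀ + n * h ≤ T →
    (∀ i, ‖ratOp L (M.Ri i) (M.c i * h) (iteratedDeriv 1 v (t₀ + n * h)) -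
      phi S 1 (M.c i * h) (iteratedDeriv 1 v (t₀ + n * h))‖ ≤ C * h ^ (p - 1)) ∧
    ‖ratOp L M.R h (iteratedDeriv 1 v (t₀ + n * h)) -
      phi S 1 h (iteratedDeriv 1 v (t₀ + n * h))‖ ≤ C * h ^ p

omit [IsScalarTower ℝ 𝕜 E] [CompleteSpace E] in
theorem grid_mem_Icc {h : ℝ} (hh : 0 < h) {n : ℕ} (hn : t₀ + n * h ≤ T) :
    t₀ + n * h ∈ Icc t₀ T :=
  ⟨by have : 0 ≤ (n : ℝ) * h := by positivity
      linarith, hn⟩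

omit [CompleteSpace E] in
theorem UniformExpansion.exists_rationalBound (H : UniformExpansion L N v p t₀ T δ ρ C)
    {u : ℝ → E} (hvu : EqOn v u (Icc t₀ T)) {M : Method 𝕜 m} {h₀ : ℝ}
    (hrat : RationalOrderConditions M S L N u t₀ T h₀ p) :
    ∃ C' : ℝ, 0 ≤ C' ∧ RationalBound M S L v p t₀ T h₀ C' := by
  obtain ⟨C', hC'⟩ := hrat
  refine ⟨|C'|, abs_nonneg _, fun h hh n hn => ?_⟩
  have ht := grid_mem_Icc hh.1 hn
  have h1 := H.mem_graph _ ht 0 (Nat.zero_le _)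
  simp only [iteratedDeriv_zero, zero_add] at h1
  have hb : ∀ k : ℕ, C' * h ^ k ≤ |C'| * h ^ k := fun k =>
    mul_le_mul_of_nonneg_right (le_abs_self _) (pow_nonneg hh.1.le _)
  rw [hvu ht] at h1
  have h2 := hC' h hh n hn _ h1
  rw [sub_add_cancel] at h2
  exact ⟨fun i => (h2.1 i).trans (hb _), h2.2.trans (hb _)⟩

omit [CompleteSpace E] in
theorem UniformExpansion.rationalStep_eq (H : UniformExpansion L N v p t₀ T δ ρ C) {t : ℝ}
    (ht : t ∈ Icc t₀ T) {R : RatFunc 𝕜} {τ : ℝ} (hR : OpsExist L R τ) :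
    rationalStep L N R τ (v t) = v t + τ • ratOp L R τ (iteratedDeriv 1 v t) := by
  have h1 := H.mem_graph t ht 0 (Nat.zero_le _)
  simp only [iteratedDeriv_zero, zero_add] at h1
  rw [IMEXP.rationalStep_eq L N R τ hR _ _ h1, sub_add_cancel]

/-- The stages started on the solution: each Picard iteration of the truncated stage equations
makes one more stage correct up to `O(h^p)`. -/
theorem UniformExpansion.exists_norm_stage_sub_le (H : UniformExpansion L N v p t₀ T δ ρ C)
    (hL : IsGenerator S L) (hp : 1 ≤ p) {M : Method 𝕜 m} {h₀ : ℝ} (hh₀ : 0 < h₀) {C_R : ℝ}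
    (hCR : 0 ≤ C_R) (hrat : RationalBound M S L v p t₀ T h₀ C_R)
    (hops : ∀ h ∈ Ioc 0 h₀, ∀ i, OpsExist L (M.Ri i) (M.c i * h)) (k : ℕ) :
    ∃ D : ℝ, 0 ≤ D ∧ ∀ᶠ h in 𝓝[>] (0 : ℝ), ∀ n : ℕ, t₀ + n * h ≤ T → ∀ i : Fin m, i.val < k →
      ‖stage M S L N h (v (t₀ + n * h)) i - v (t₀ + n * h + M.c i * h) -
        approxStage M S p h (elemMap N v p (t₀ + n * h) h) (elemVec N v p (t₀ + n * h) h) k i‖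
        ≤ D * h ^ p := by
  induction k with
  | zero => exact ⟨0, le_rfl, Eventually.of_forall fun h n _ i hi => absurd hi (Nat.not_lt_zero _)⟩
  | succ k ih =>
    obtain ⟨D₁, hD₁, h1⟩ := ih
    obtain ⟨D₂, hD₂, h2⟩ := exists_norm_approxStage_le M S p k 1 C H.nonneg
    choose D₃ hD₃ h3 using fun i : Fin m => H.exists_norm_update_le hL hp M
      (Finset.univ.filter (fun j => j < i)) (M.a i) (M.c_nonneg i) (add_nonneg hD₁ hD₂)
    have hpos : ∀ i, 0 ≤ M.c i * C_R + D₃ i := fun i =>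
      add_nonneg (mul_nonneg (M.c_nonneg i) hCR) (hD₃ i)
    refine ⟨∑ i, (M.c i * C_R + D₃ i), Finset.sum_nonneg fun i _ => hpos i, ?_⟩
    filter_upwards [h1, eventually_all.2 h3, Ioc_mem_nhdsGT zero_lt_one, Ioc_mem_nhdsGT hh₀]
      with h h1 h3 hh hh' n hn i hi
    have ht := grid_mem_Icc hh.1 hn
    set t := t₀ + n * h with htdef
    set Y := approxStage M S p h (elemMap N v p t h) (elemVec N v p t h) k with hY
    have hh0 := hh.1.le
    have e1 := h3 i t ht (fun j => stage M S L N h (v t) j - v (t + M.c j * h)) Y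
      (fun j _ => (h2 h ⟨hh0, hh.2⟩ _ _ (H.scaled ht hh0) j).trans
        (mul_le_mul_of_nonneg_right (by linarith) hh0))
      (fun j hj => by
        have hj' : j < i := by simpa using hj
        refine (h1 n hn j (lt_of_lt_of_le hj' (Nat.lt_succ_iff.1 hi))).trans
          (mul_le_mul_of_nonneg_right (by linarith) (pow_nonneg hh0 _)))
    have e2 : ‖(M.c i * h) • (ratOp L (M.Ri i) (M.c i * h) (iteratedDeriv 1 v t) -
        phi S 1 (M.c i * h) (iteratedDeriv 1 v t))‖ ≤ M.c i * C_R * h ^ p := by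
      have hci := M.c_nonneg i
      rw [norm_smul, Real.norm_of_nonneg (by positivity)]
      calc _ ≤ M.c i * h * (C_R * h ^ (p - 1)) := by
            gcongr
            exact (hrat h hh' n hn).1 i
        _ = M.c i * C_R * (h ^ (p - 1) * h) := by ring
        _ = _ := by rw [← pow_succ, Nat.sub_add_cancel hp]
    have e3 : D₃ i * h ^ (p + 1) ≤ D₃ i * h ^ p :=
      mul_le_mul_of_nonneg_left (pow_le_pow_of_le_one hh0 hh.2 (Nat.le_succ p)) (hD₃ i)
    have e4 := (norm_add_le _ _).trans (add_le_add e2 (e1.trans e3))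
    rw [← add_mul] at e4
    refine le_trans (le_of_eq ?_) (e4.trans (mul_le_mul_of_nonneg_right
      (Finset.single_le_sum (fun i _ => hpos i) (Finset.mem_univ i)) (pow_nonneg hh0 _)))
    congr 1
    rw [stage_eq, approxStage, H.rationalStep_eq ht (hops h hh' i)]
    simp only [stageExpr, add_sub_cancel, smul_sub]
    abel

/-- One step of the method started on the solution is accurate up to `O(h^(p+1))`. -/
theorem UniformExpansion.exists_norm_step_sub_le (H : UniformExpansion L N v p t₀ T δ ρ C)
    (hL : IsGenerator S L) (hp : 1 ≤ p) {M : Method 𝕜 m} {h₀ : ℝ} (hh₀ : 0 < h₀) {C_R : ℝ}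
    (hCR : 0 ≤ C_R) (hrat : RationalBound M S L v p t₀ T h₀ C_R)
    (hops : ∀ h ∈ Ioc 0 h₀, OpsExist L M.R h ∧ ∀ i, OpsExist L (M.Ri i) (M.c i * h))
    (horder : ∀ h ∈ Ioc 0 h₀, StiffOrderConditions M S h p) :
    ∃ D : ℝ, 0 ≤ D ∧ ∀ᶠ h in 𝓝[>] (0 : ℝ), ∀ n : ℕ, t₀ + n * h ≤ T →
      ‖step M S L N h (v (t₀ + n * h)) - v (t₀ + n * h + h)‖ ≤ D * h ^ (p + 1) := by
  obtain ⟨D₁, hD₁, h1⟩ := H.exists_norm_stage_sub_le hL hp hh₀ hCR hrat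
    (fun h hh => (hops h hh).2) m
  obtain ⟨D₂, hD₂, h2⟩ := exists_norm_approxStage_le M S p m 1 C H.nonneg
  obtain ⟨D₃, hD₃, h3⟩ := H.exists_norm_update_le hL hp M Finset.univ M.b zero_le_one
    (add_nonneg hD₁ hD₂)
  obtain ⟨D₄, hD₄, h4⟩ := exists_norm_root_le M S p m 1 C H.nonneg
  refine ⟨C_R + (D₃ + D₄), by positivity, ?_⟩
  filter_upwards [h1, h3, Ioc_mem_nhdsGT zero_lt_one, Ioc_mem_nhdsGT hh₀]
    with h h1 h3 hh hh' n hn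
  have ht := grid_mem_Icc hh.1 hn
  set t := t₀ + n * h with htdef
  set Y := approxStage M S p h (elemMap N v p t h) (elemVec N v p t h) m with hY
  have hh0 := hh.1.le
  have e1 := h3 t ht (fun j => stage M S L N h (v t) j - v (t + M.c j * h)) Y
    (fun j _ => (h2 h ⟨hh0, hh.2⟩ _ _ (H.scaled ht hh0) j).trans
      (mul_le_mul_of_nonneg_right (by linarith) hh0))
    (fun j _ => (h1 n hn j j.isLt).trans
      (mul_le_mul_of_nonneg_right (by linarith) (pow_nonneg hh0 _)))
  have e2 := h4 h ⟨hh0, hh.2⟩ (horder h hh') _ _ (H.scaled ht hh0)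
  have e3 : ‖h • (ratOp L M.R h (iteratedDeriv 1 v t) - phi S 1 h (iteratedDeriv 1 v t))‖
      ≤ C_R * h ^ (p + 1) := by
    rw [norm_smul, Real.norm_of_nonneg hh0]
    calc _ ≤ h * (C_R * h ^ p) := by
          gcongr
          exact (hrat h hh' n hn).2
      _ = _ := by ring
  -- the leaf expressions vanish by the order conditions
  have hleaf : ∑ q ∈ Finset.range (p - 1), (∑ j, (M.c j ^ (q + 1) / ((q + 1).factorial : ℝ)) •
      (M.b j).eval S h (elemVec N v p t h (q + 2)) -
        (1 : ℝ) ^ (q + 2) • phi S (q + 2) (1 * h) (elemVec N v p t h (q + 2))) = 0 := by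
    refine Finset.sum_eq_zero fun q hq => ?_
    rw [Finset.mem_range] at hq
    have := horder h hh' (elemMap N v p t h) (elemVec N v p t h) (.leaf q)
      (by simp only [StiffTree.order]; omega)
    simpa [rootExpr] using this
  rw [hleaf, zero_add] at e1
  have e4 := (norm_add_le _ _).trans (add_le_add e3 ((norm_add_le _ _).trans (add_le_add e1 e2)))
  rw [← add_mul, ← add_mul] at e4
  refine le_trans (le_of_eq ?_) e4
  congr 1
  rw [step, H.rationalStep_eq ht (hops h hh').1]
  simp only [add_sub_cancel, one_mul, smul_sub]
  abel

end LocalError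

/-! ### Stability and the global error -/

section GlobalError

variable {𝕜 : Type*} [RCLike 𝕜] {E : Type*} [NormedAddCommGroup E]
  [NormedSpace 𝕜 E] {m : ℕ}

/-- A discrete Gronwall argument for the recursion `e_{n+1} = B e_n + r_n` with power bounded `B`.
The bound on `r_n` is available only while `e_n` stays in the ball of radius `σ`; the conclusion
itself keeps `e_n` there. -/
theorem norm_le_of_powerBounded {B : E →L[𝕜] E} {e : ℕ → E} {n₀ : ℕ} {K C h η σ G : ℝ}
    (hK : 1 ≤ K) (hC : 0 ≤ C) (hh : 0 ≤ h) (hη : 0 ≤ η) (hB : ∀ k ≤ n₀, ‖B ^ k‖ ≤ K)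
    (he : e 0 = 0) (hG : ∀ n ≤ n₀, K * C * (n * h) ≤ G) (hσ : Real.exp G * η ≤ σ)
    (hstep : ∀ n < n₀, ‖e n‖ ≤ σ → ‖e (n + 1) - B (e n)‖ ≤ C * h * (‖e n‖ + η)) :
    ∀ n ≤ n₀, ‖e n‖ ≤ Real.exp G * η := by
  set a := K * C * h with ha
  have ha0 : 0 ≤ a := by positivity
  -- discrete variation of constants
  have hsum : ∀ n, e n = ∑ j ∈ Finset.range n, (B ^ (n - 1 - j)) (e (j + 1) - B (e j)) := by
    intro n
    induction n with
    | zero => simpa using he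
    | succ n ih =>
      rw [Finset.sum_range_succ]
      have h1 : ∑ j ∈ Finset.range n, (B ^ (n + 1 - 1 - j)) (e (j + 1) - B (e j)) = B (e n) := by
        conv_rhs => rw [ih]
        rw [map_sum]
        refine Finset.sum_congr rfl fun j hj => ?_
        rw [Finset.mem_range] at hj
        rw [show n + 1 - 1 - j = (n - 1 - j) + 1 by omega, pow_succ']
        rfl
      rw [h1]; simp
  have hexp : ∀ n ≤ n₀, ((1 + a) ^ n - 1) * η ≤ Real.exp G * η := by
    intro n hn
    refine mul_le_mul_of_nonneg_right ?_ hη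
    have h1 : (1 + a) ^ n ≤ Real.exp a ^ n :=
      pow_le_pow_left₀ (by positivity) (by linarith [Real.add_one_le_exp a]) n
    rw [← Real.exp_nat_mul] at h1
    have h2 : Real.exp (n * a) ≤ Real.exp G :=
      Real.exp_le_exp.2 (le_of_eq_of_le (by rw [ha]; ring) (hG n hn))
    linarith
  have hmain : ∀ n ≤ n₀, ‖e n‖ ≤ ((1 + a) ^ n - 1) * η := by
    intro n
    induction n using Nat.strong_induction_on with
    | _ n ih =>
      intro hn
      have h1 : ∀ j ∈ Finset.range n, ‖(B ^ (n - 1 - j)) (e (j + 1) - B (e j))‖ ≤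
          (1 + a) ^ j * (a * η) := by
        intro j hj
        rw [Finset.mem_range] at hj
        have h2 := ih j hj (by omega)
        have h3 := hstep j (by omega) ((h2.trans (hexp j (by omega))).trans hσ)
        calc _ ≤ K * (C * h * (‖e j‖ + η)) := by
              refine ((B ^ (n - 1 - j)).le_of_opNorm_le (hB _ (by omega)) _).trans ?_
              gcongr
          _ ≤ K * (C * h * (((1 + a) ^ j - 1) * η + η)) := by gcongr
          _ = _ := by rw [ha]; ring
      rw [hsum n]
      refine (norm_sum_le_of_le _ h1).trans (le_of_eq ?_)
      rw [← Finset.sum_mul, ← geom_sum_mul (1 + a) n]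
      ring
  exact fun n hn => (hmain n hn).trans (hexp n hn)

variable [NormedSpace ℝ E]

theorem norm_rationalStep_sub_le {L : E →ₗ.[𝕜] E} {N : E → E} {R : RatFunc 𝕜} {τ K : ℝ}
    (hτ : 0 ≤ τ) (hR : ‖ratOp L R τ‖ ≤ K) (x y : E) :
    ‖rationalStep L N R τ x - rationalStep L N R τ y - stabOp L R τ (x - y)‖
      ≤ τ * (K * ‖N x - N y‖) := by
  have : rationalStep L N R τ x - rationalStep L N R τ y - stabOp L R τ (x - y) =
      τ • ratOp L R τ (N x - N y) := by
    simp only [rationalStep, map_sub, smul_sub]; abel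
  rw [this, norm_smul, Real.norm_of_nonneg hτ]
  gcongr
  exact (ratOp L R τ).le_of_opNorm_le hR _

variable [IsScalarTower ℝ 𝕜 E] [CompleteSpace E] {S : C0Semigroup 𝕜 E} {L : E →ₗ.[𝕜] E}
  {N : E → E} {v : ℝ → E} {p : ℕ} {t₀ T δ ρ C : ℝ}

/-- The stages started on the solution stay close to the solution curve. -/
theorem UniformExpansion.eventually_norm_stage_sub_lt
    (H : UniformExpansion L N v p t₀ T δ ρ C) (hL : IsGenerator S L) (hp : 1 ≤ p)
    {M : Method 𝕜 m} {h₀ : ℝ} (hh₀ : 0 < h₀) {C_R : ℝ} (hCR : 0 ≤ C_R)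
    (hrat : RationalBound M S L v p t₀ T h₀ C_R)
    (hops : ∀ h ∈ Ioc 0 h₀, ∀ i, OpsExist L (M.Ri i) (M.c i * h)) {ε : ℝ} (hε : 0 < ε) :
    ∀ᶠ h in 𝓝[>] (0 : ℝ), ∀ n : ℕ, t₀ + n * h ≤ T → ∀ i : Fin m,
      ‖stage M S L N h (v (t₀ + n * h)) i - v (t₀ + n * h + M.c i * h)‖ < ε := by
  obtain ⟨D₁, hD₁, h1⟩ := H.exists_norm_stage_sub_le hL hp hh₀ hCR hrat hops m
  obtain ⟨D₂, hD₂, h2⟩ := exists_norm_approxStage_le M S p m 1 C H.nonneg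
  have hlim : ∀ᶠ h in 𝓝[>] (0 : ℝ), (D₁ + D₂) * h < ε :=
    nhdsWithin_le_nhds ((Continuous.tendsto' (f := fun h : ℝ => (D₁ + D₂) * h) (by fun_prop) 0 0
      (by simp)).eventually_lt_const hε)
  filter_upwards [h1, hlim, Ioc_mem_nhdsGT zero_lt_one] with h h1 hlim hh n hn i
  have ht := grid_mem_Icc hh.1 hn
  have e1 := h1 n hn i i.isLt
  have e2 := h2 h ⟨hh.1.le, hh.2⟩ _ _ (H.scaled ht hh.1.le) i
  have e3 : D₁ * h ^ p ≤ D₁ * h :=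
    mul_le_mul_of_nonneg_left (pow_le_of_le_one hh.1.le hh.2 (by omega)) hD₁
  have e4 := (norm_add_le _ _).trans (add_le_add e1 e2)
  rw [sub_add_cancel] at e4
  linarith

/-- The stages depend Lipschitz continuously on the initial value near the solution. -/
theorem UniformExpansion.exists_stage_lipschitz (H : UniformExpansion L N v p t₀ T δ ρ C)
    {M : Method 𝕜 m} {h₀ : ℝ} (hh₀ : 0 < h₀) {K : ℝ} (hK : 0 ≤ K)
    (hstab : ∀ h ∈ Ioc 0 h₀, ∀ i,
      ‖ratOp L (M.Ri i) (M.c i * h)‖ ≤ K ∧ ‖stabOp L (M.Ri i) (M.c i * h)‖ ≤ K)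
    (hclose : ∀ᶠ h in 𝓝[>] (0 : ℝ), ∀ n : ℕ, t₀ + n * h ≤ T → ∀ i : Fin m,
      ‖stage M S L N h (v (t₀ + n * h)) i - v (t₀ + n * h + M.c i * h)‖ < ρ / 2) (k : ℕ) :
    ∃ D : ℝ, 0 ≤ D ∧ ∃ σ > 0, σ < ρ ∧ ∀ᶠ h in 𝓝[>] (0 : ℝ), ∀ n : ℕ, t₀ + n * h ≤ T →
      ∀ x : E, ‖x - v (t₀ + n * h)‖ ≤ σ → ∀ i : Fin m, i.val < k →
        ‖N (stage M S L N h x i) - N (stage M S L N h (v (t₀ + n * h)) i)‖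
          ≤ D * ‖x - v (t₀ + n * h)‖ := by
  have hC := H.nonneg
  have hρ := H.rho_pos
  induction k with
  | zero => exact ⟨0, le_rfl, ρ / 2, by positivity, by linarith,
      Eventually.of_forall fun h n _ x _ i hi => absurd hi (Nat.not_lt_zero _)⟩
  | succ k ih =>
    obtain ⟨D₁, hD₁, σ, hσ, hσρ, h1⟩ := ih
    choose D₂ hD₂ h2 using fun i : Fin m => exists_norm_sum_eval_le S 1
      (Finset.univ.filter (fun j => j < i)) (M.a i) (fun _ => 1)
    -- Lipschitz constant of the stages themselves
    set Λ : ℝ := ∑ i, (K + M.c i * (K * C) + D₂ i * (D₁ + C)) with hΛ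
    have hpos : ∀ i, 0 ≤ K + M.c i * (K * C) + D₂ i * (D₁ + C) := fun i => by
      have := M.c_nonneg i
      have := hD₂ i
      positivity
    have hΛ0 : 0 ≤ Λ := Finset.sum_nonneg fun i _ => hpos i
    refine ⟨C * Λ, by positivity, min σ (ρ / (2 * (Λ + 1))), by positivity,
      (min_le_left _ _).trans_lt hσρ, ?_⟩
    have hδ : ∀ᶠ h in 𝓝[>] (0 : ℝ), ∀ i, M.c i * h < δ :=
      eventually_all.2 fun i => nhdsWithin_le_nhds ((Continuous.tendsto'
        (f := fun h : ℝ => M.c i * h) (by fun_prop) 0 0 (by simp)).eventually_lt_const H.delta_pos)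
    filter_upwards [h1, hclose, hδ, Ioc_mem_nhdsGT zero_lt_one, Ioc_mem_nhdsGT hh₀]
      with h h1 hclose hδ hh hh' n hn x hx i hi
    have ht := grid_mem_Icc hh.1 hn
    set t := t₀ + n * h with htdef
    have hh0 := hh.1.le
    have hx1 : ‖x - v t‖ ≤ σ := hx.trans (min_le_left _ _)
    have hx2 : ‖x - v t‖ ≤ ρ / (2 * (Λ + 1)) := hx.trans (min_le_right _ _)
    have hN : ‖N x - N (v t)‖ ≤ C * ‖x - v t‖ := by
      have := H.lipschitz t ht 0 ⟨le_rfl, H.delta_pos.le⟩ (x - v t) 0 (hx1.trans_lt hσρ)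
        (by simpa using hρ)
      simpa using this
    -- the `i`-th stages for `x` and `v t` differ by the rational steps and by earlier stages
    have hst : ‖stage M S L N h x i - stage M S L N h (v t) i‖ ≤ Λ * ‖x - v t‖ := by
      have hci := M.c_nonneg i
      have hst := hstab h hh' i
      have e1 := norm_rationalStep_sub_le (N := N) (mul_nonneg hci hh0) hst.1 x (v t)
      have e2 := (stabOp L (M.Ri i) (M.c i * h)).le_of_opNorm_le hst.2 (x - v t)
      have e3 := h2 i h ⟨hh0, hh.2⟩ (fun j => (N (stage M S L N h x j) - N x) -
          (N (stage M S L N h (v t) j) - N (v t))) ((D₁ + C) * ‖x - v t‖) (fun j hj => by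
        have hj' : j < i := by simpa using hj
        have e4 := h1 n hn x hx1 j (lt_of_lt_of_le hj' (Nat.lt_succ_iff.1 hi))
        rw [sub_sub_sub_comm]
        refine (norm_sub_le _ _).trans ?_
        rw [add_mul]
        exact add_le_add e4 hN)
      have e3' : ‖h • ∑ j ∈ Finset.univ.filter (fun j => j < i), (1 : ℝ) • (M.a i j).eval S h
          ((N (stage M S L N h x j) - N x) - (N (stage M S L N h (v t) j) - N (v t)))‖ ≤
          D₂ i * ((D₁ + C) * ‖x - v t‖) := by
        rw [norm_smul, Real.norm_of_nonneg hh0]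
        exact (mul_le_of_le_one_left (norm_nonneg _) hh.2).trans e3
      have e1' : M.c i * h * (K * ‖N x - N (v t)‖) ≤ M.c i * (K * (C * ‖x - v t‖)) := by
        refine mul_le_mul (mul_le_of_le_one_right hci hh.2) ?_ (by positivity) hci
        gcongr
      have e5 := norm_add₃_le.trans (add_le_add (add_le_add (e1.trans e1') e2) e3')
      calc _ ≤ M.c i * (K * (C * ‖x - v t‖)) + K * ‖x - v t‖ +
            D₂ i * ((D₁ + C) * ‖x - v t‖) := by
            refine le_trans (le_of_eq ?_) e5
            congr 1
            rw [stage_eq, stage_eq M S L N h (v t) i]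
            simp only [one_smul, ExpCoeff.eval_sub _ _ hh0, Finset.sum_sub_distrib, smul_sub]
            abel
        _ = (K + M.c i * (K * C) + D₂ i * (D₁ + C)) * ‖x - v t‖ := by ring
        _ ≤ _ := mul_le_mul_of_nonneg_right
            (Finset.single_le_sum (fun i _ => hpos i) (Finset.mem_univ i)) (norm_nonneg _)
    have hsmall : Λ * ‖x - v t‖ < ρ / 2 := by
      calc Λ * ‖x - v t‖ ≤ Λ * (ρ / (2 * (Λ + 1))) := by gcongr
        _ < (Λ + 1) * (ρ / (2 * (Λ + 1))) := by
            have : 0 < ρ / (2 * (Λ + 1)) := by positivity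
            nlinarith
        _ = ρ / 2 := by field_simp
    have hc := hclose n hn i
    have e6 := H.lipschitz t ht (M.c i * h) ⟨mul_nonneg (M.c_nonneg i) hh0, (hδ i).le⟩
      (stage M S L N h x i - v (t + M.c i * h)) (stage M S L N h (v t) i - v (t + M.c i * h))
      (by
        have := norm_add_le (stage M S L N h x i - stage M S L N h (v t) i)
          (stage M S L N h (v t) i - v (t + M.c i * h))
        rw [sub_add_sub_cancel] at this
        linarith) (by linarith)
    rw [add_sub_cancel, add_sub_cancel, sub_sub_sub_cancel_right] at e6
    exact (e6.trans (mul_le_mul_of_nonneg_left hst hC)).trans (le_of_eq (by ring))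

/-- Up to `O(h)` times the difference of the initial values, one step acts on differences as
`I + R(hL)hL`. -/
theorem UniformExpansion.exists_step_sub_le (H : UniformExpansion L N v p t₀ T δ ρ C)
    {M : Method 𝕜 m} {h₀ : ℝ} (hh₀ : 0 < h₀) {K : ℝ} (hK : 0 ≤ K)
    (hstab : ∀ h ∈ Ioc 0 h₀, ‖ratOp L M.R h‖ ≤ K ∧ ∀ i,
      ‖ratOp L (M.Ri i) (M.c i * h)‖ ≤ K ∧ ‖stabOp L (M.Ri i) (M.c i * h)‖ ≤ K)
    (hclose : ∀ᶠ h in 𝓝[>] (0 : ℝ), ∀ n : ℕ, t₀ + n * h ≤ T → ∀ i : Fin m,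
      ‖stage M S L N h (v (t₀ + n * h)) i - v (t₀ + n * h + M.c i * h)‖ < ρ / 2) :
    ∃ D : ℝ, 0 ≤ D ∧ ∃ σ > 0, ∀ᶠ h in 𝓝[>] (0 : ℝ), ∀ n : ℕ, t₀ + n * h ≤ T →
      ∀ x : E, ‖x - v (t₀ + n * h)‖ ≤ σ →
        ‖step M S L N h x - step M S L N h (v (t₀ + n * h)) -
          stabOp L M.R h (x - v (t₀ + n * h))‖ ≤ D * h * ‖x - v (t₀ + n * h)‖ := by
  have hC := H.nonneg
  obtain ⟨D₁, hD₁, σ, hσ, hσρ, h1⟩ := H.exists_stage_lipschitz hh₀ hK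
    (fun h hh => (hstab h hh).2) hclose m
  obtain ⟨D₂, hD₂, h2⟩ := exists_norm_sum_eval_le S 1 Finset.univ M.b (fun _ => 1)
  refine ⟨K * C + D₂ * (D₁ + C), by positivity, σ, hσ, ?_⟩
  filter_upwards [h1, Ioc_mem_nhdsGT zero_lt_one, Ioc_mem_nhdsGT hh₀] with h h1 hh hh' n hn x hx
  have ht := grid_mem_Icc hh.1 hn
  set t := t₀ + n * h with htdef
  have hh0 := hh.1.le
  have hN : ‖N x - N (v t)‖ ≤ C * ‖x - v t‖ := by
    have := H.lipschitz t ht 0 ⟨le_rfl, H.delta_pos.le⟩ (x - v t) 0 (hx.trans_lt hσρ)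
      (by simpa using H.rho_pos)
    simpa using this
  have e1 := norm_rationalStep_sub_le (N := N) hh0 (hstab h hh').1 x (v t)
  have e3 := h2 h ⟨hh0, hh.2⟩ (fun j => (N (stage M S L N h x j) - N x) -
      (N (stage M S L N h (v t) j) - N (v t))) ((D₁ + C) * ‖x - v t‖) (fun j _ => by
    have e4 := h1 n hn x hx j j.isLt
    rw [sub_sub_sub_comm]
    refine (norm_sub_le _ _).trans ?_
    rw [add_mul]
    exact add_le_add e4 hN)
  have e3' : ‖h • ∑ j, (1 : ℝ) • (M.b j).eval S h
      ((N (stage M S L N h x j) - N x) - (N (stage M S L N h (v t) j) - N (v t)))‖ ≤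
      h * (D₂ * ((D₁ + C) * ‖x - v t‖)) := by
    rw [norm_smul, Real.norm_of_nonneg hh0]
    gcongr
  have e1' : h * (K * ‖N x - N (v t)‖) ≤ h * (K * (C * ‖x - v t‖)) := by gcongr
  have e5 := (norm_add_le _ _).trans (add_le_add (e1.trans e1') e3')
  refine le_trans (le_of_eq ?_) (e5.trans (le_of_eq (by ring)))
  congr 1
  rw [step, step]
  simp only [one_smul, ExpCoeff.eval_sub _ _ hh0, Finset.sum_sub_distrib, smul_sub]
  abel

end GlobalError

end IMEXP

/-! ### Convergence -/

theorem mainTheorem2 {𝕜 : Type*} [RCLike 𝕜] {E : Type*} [NormedAddCommGroup E]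
    [NormedSpace ℝ E] [NormedSpace 𝕜 E] [IsScalarTower ℝ 𝕜 E] [CompleteSpace E]
    (S : IMEXP.C0Semigroup 𝕜 E) (L : E →ₗ.[𝕜] E) (hL : IMEXP.IsGenerator S L)
    (N : E → E) (u₀ : E) (t₀ T : ℝ) (hT : t₀ < T) (u : ℝ → E)
    (hu : IMEXP.IsSolution L N u₀ t₀ T u)
    (p : ℕ) (hp : 1 ≤ p) (hreg : IMEXP.Regular 𝕜 N u t₀ T (p + 1))
    {m : ℕ} (M : IMEXP.Method 𝕜 m) (h₀ : ℝ) (hh₀ : 0 < h₀)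
    (horder : ∀ h ∈ Set.Ioc 0 h₀, IMEXP.StiffOrderConditions M S h p)
    (hrat : IMEXP.RationalOrderConditions M S L N u t₀ T h₀ p)
    (hstab : IMEXP.StabilityBounds M L h₀)
    (hpow : IMEXP.PowerBounded M L t₀ T h₀) :
    ∃ h₁ ∈ Set.Ioc 0 h₀, ∃ C : ℝ, ∀ h ∈ Set.Ioc 0 h₁, ∀ n : ℕ, t₀ + n * h ≤ T →
      ‖IMEXP.numSol M S L N u₀ h n - u (t₀ + n * h)‖ ≤ C * h ^ p := by
  obtain ⟨v, δ, ρ, C, hvu, H⟩ := IMEXP.exists_uniformExpansion hL hT hu hreg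
  obtain ⟨C_R, hCR, hratv⟩ := H.exists_rationalBound hvu hrat
  obtain ⟨hops, K, hK⟩ := hstab
  have hK0 : 0 ≤ K := (norm_nonneg _).trans (hK h₀ ⟨hh₀, le_rfl⟩).1
  obtain ⟨C_S, hCS⟩ := hpow
  obtain ⟨D₁, hD₁, h1⟩ := H.exists_norm_step_sub_le hL hp hh₀ hCR hratv hops horder
  obtain ⟨D₂, hD₂, σ, hσ, h2⟩ := H.exists_step_sub_le hh₀ hK0 hK
    (H.eventually_norm_stage_sub_lt hL hp hh₀ hCR hratv (fun h hh => (hops h hh).2)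
      (half_pos H.rho_pos))
  set K' : ℝ := max 1 C_S with hK'
  have hK'1 : 1 ≤ K' := le_max_left _ _
  set G : ℝ := K' * (D₁ + D₂) * (T - t₀) with hG
  have hlim : ∀ᶠ h in 𝓝[>] (0 : ℝ), Real.exp G * h ^ p < σ :=
    nhdsWithin_le_nhds ((Continuous.tendsto' (f := fun h : ℝ => Real.exp G * h ^ p)
      (by fun_prop) 0 0 (by simp; omega)).eventually_lt_const hσ)
  obtain ⟨ε, hε, hsub⟩ := mem_nhdsGT_iff_exists_Ioc_subset.1
    (h1.and (h2.and hlim))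
  refine ⟨min h₀ ε, ⟨lt_min hh₀ hε, min_le_left _ _⟩, Real.exp G, fun h hh n₀ hn₀ => ?_⟩
  have hh' : h ∈ Ioc 0 h₀ := ⟨hh.1, hh.2.trans (min_le_left _ _)⟩
  obtain ⟨h1, h2, hlim⟩ := hsub (show h ∈ Ioc 0 ε from ⟨hh.1, hh.2.trans (min_le_right _ _)⟩)
  have hh0 := hh.1.le
  have hgrid : ∀ n ≤ n₀, t₀ + n * h ≤ T := fun n hn => by
    have : (n : ℝ) * h ≤ n₀ * h := mul_le_mul_of_nonneg_right (by exact_mod_cast hn) hh0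
    linarith
  rw [← hvu (IMEXP.grid_mem_Icc hh.1 hn₀)]
  refine IMEXP.norm_le_of_powerBounded (B := IMEXP.stabOp L M.R h)
    (e := fun n => IMEXP.numSol M S L N u₀ h n - v (t₀ + n * h)) (n₀ := n₀) (σ := σ)
    hK'1 (add_nonneg hD₁ hD₂) hh0 (pow_nonneg hh0 p) (fun k hk => ?_) ?_ (fun n hn => ?_) hlim.le
    (fun n hn hen => ?_) n₀ le_rfl
  · rcases Nat.eq_zero_or_pos k with rfl | hk0
    · rw [pow_zero]
      exact ContinuousLinearMap.norm_id_le.trans hK'1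
    · have := hCS h hh' n₀ hn₀ (n₀ - k) (by omega)
      rw [Nat.sub_sub_self hk] at this
      exact this.trans (le_max_right _ _)
  · simp [IMEXP.numSol, hvu ⟨le_rfl, hT.le⟩, hu.1]
  · have := hgrid n hn
    rw [hG]
    gcongr
    linarith
  · have e1 := h1 n (hgrid n hn.le)
    have e2 := h2 n (hgrid n hn.le) _ hen
    have e3 : t₀ + ((n + 1 : ℕ) : ℝ) * h = t₀ + n * h + h := by push_cast; ring
    have e4 := (norm_add_le _ _).trans (add_le_add e2 e1)
    simp only [e3, IMEXP.numSol]
    set x := IMEXP.numSol M S L N u₀ h n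
    calc _ = ‖IMEXP.step M S L N h x - IMEXP.step M S L N h (v (t₀ + n * h)) -
          IMEXP.stabOp L M.R h (x - v (t₀ + n * h)) +
          (IMEXP.step M S L N h (v (t₀ + n * h)) - v (t₀ + n * h + h))‖ := by
          congr 1; abel
      _ ≤ _ := e4
      _ ≤ _ := by
          rw [pow_succ]
          have a1 : 0 ≤ D₁ * h * ‖x - v (t₀ + n * h)‖ := by positivity
          have a2 : 0 ≤ D₂ * h * h ^ p := by positivity
          nlinarith
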